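/- Fix a dimension $p$. For every $n$ let $z_{ij}=z_{ij}^{(n)}=z_{ji}\in\mathbb{R}^p$ ($i\ne j$) be given covariates, $z_*=\max_{i\neq j}\|z_{ij}\|_\infty$, and let $\beta^*=\beta^{*(n)}\in\mathbb{R}^n$, $\gamma^*=\gamma^{*(n)}\in\mathbb{R}^p$ be the true parameters; let $k_n\ge 1$ be integers and $\epsilon_n>0$. Write $\mu(x)=e^x/(1+e^x)$, $\pi_{ij}=\beta_i+\beta_j+z_{ij}^\top\gamma$ and $\mu_{ij}(\beta,\gamma)=\mu(\pi_{ij})$. In the covariate-adjusted $\beta$-model an undirected simple graph on $n$ nodes has independent edge indicators $a_{ij}=a_{ji}$ ($i<j$) with $\mathbb{P}(a_{ij}=1)=\mu_{ij}(\beta^*,\gamma^*)$. The degrees $d_i=\sum_{j\neq i}a_{ij}$ and the vector $y=\sum_{i<j}a_{ij}z_{ij}$ are released as $\tilde d_i=d_i+\xi_i$ and $\tilde y_t=y_t+\eta_t$, where all $\xi_i$, $\eta_t$ are independent of each other and of the graph, $\xi_i$ has the discrete Laplace law $\mathbb{P}(\xi_i=x)=\frac{1-\lambda}{1+\lambda}\lambda^{|x|}$,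 $x\in\mathbb{Z}$, with $\lambda=e^{-\epsilon_n/(4k_n)}$, and $\eta_t$ has the Laplace law with scale $2pk_nz_*/\epsilon_n$ (that is, $\eta_t=0$ if this scale is $0$). The estimator $(\hat\beta,\hat\gamma)$ is a solution of $$\tilde d_i=\sum_{j\neq i}\mu_{ij}(\beta,\gamma)\ (i=1,\dots,n),\qquad \tilde y=\sum_{i<j}z_{ij}\mu_{ij}(\beta,\gamma)$$ (with arbitrary values where no solution exists). For radii $\epsilon_{n1},\epsilon_{n2}>0$ and the closed balls $B(x,r)=\{x':\|x'-x\|_\infty\le r\}$ let $$b_n=\sup_{\beta\in B(\beta^*,\epsilon_{n1}),\,\gamma\in B(\gamma^*,\epsilon_{n2})}\ \max_{i\neq j}\frac{(1+e^{\pi_{ij}})^2}{e^{\pi_{ij}}}.$$ With $F_i(\beta,\gamma)=\sum_{j\neq i}\mu_{ij}(\beta,\gamma)-\tilde d_i$ and $Q(\beta,\gamma)=\sum_{i<j}z_{ij}\mu_{ij}(\beta,\gamma)-\tilde y$ put $$H(\beta,\gamma)=\frac{\partial Q}{\partial\gamma}-\frac{\partial Q}{\partial\beta}\Big[\frac{\partial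 F}{\partial\beta}\Big]^{-1}\frac{\partial F}{\partial\gamma},$$ and let $\rho_n$ be numbers such that, for all sufficiently large $n$ and all $\beta\in B(\beta^*,\epsilon_{n1})$, the matrix $H(\beta,\gamma^*)$ is invertible and $\|H^{-1}(\beta,\gamma^*)\|_\infty\le\rho_n/n^2$, where $\|\cdot\|_\infty$ of a matrix is the largest absolute row sum. Suppose that, as $n\to\infty$, $k_n/\epsilon_n\to0$, $b_n=o((n/\log n)^{1/4})$, $\rho_nb_n^3=o(n^{1/2}/\log n)$ and $z_*=o((\log n)^{1/2})$. Then the estimator $(\hat\beta,\hat\gamma)$ exists with probability tending to one, and $$\|\hat\gamma-\gamma^*\|_\infty=O_p\Big(\frac{\rho_nb_n^3\log n}{n}\Big),\qquad \|\hat\beta-\beta^*\|_\infty=O_p\Big(b_n\Big(\frac{\log n}{n}\Big)^{1/2}\Big).$$ -/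

import Mathlib

open MeasureTheory ProbabilityTheory Filter Topology Asymptotics
open scoped ENNReal

noncomputable section

namespace CovBeta

/-- The unordered pairs of distinct nodes, represented as `i < j`. -/
abbrev Pair (n : ℕ) : Type := {e : Fin n × Fin n // e.1 < e.2}

/-- The linear predictor `π_{ij} = β_i + β_j + z_{ij}ᵀ γ`. -/
def linPred {n p : ℕ} (z : Fin n → Fin n → Fin p → ℝ) (β : Fin n → ℝ) (γ : Fin p → ℝ)
    (i j : Fin n) : ℝ :=
  β i + β j + ∑ t, z i j t * γ t

/-- `μ_{ij}(β, γ) = e^{π_{ij}} / (1 + e^{π_{ij}})`. -/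
def edgeProb {n p : ℕ} (z : Fin n → Fin n → Fin p → ℝ) (β : Fin n → ℝ) (γ : Fin p → ℝ)
    (i j : Fin n) : ℝ :=
  Real.sigmoid (linPred z β γ i j)

/-- `∑_{j ≠ i} μ_{ij}(β, γ)`, the expected degree of node `i`. -/
def meanDegree {n p : ℕ} (z : Fin n → Fin n → Fin p → ℝ) (β : Fin n → ℝ) (γ : Fin p → ℝ)
    (i : Fin n) : ℝ :=
  ∑ j ∈ Finset.univ.erase i, edgeProb z β γ i j

/-- `∑_{i < j} z_{ij} μ_{ij}(β, γ)`, the expected covariate statistic. -/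
def meanCov {n p : ℕ} (z : Fin n → Fin n → Fin p → ℝ) (β : Fin n → ℝ) (γ : Fin p → ℝ)
    (t : Fin p) : ℝ :=
  ∑ e : Pair n, z e.1.1 e.1.2 t * edgeProb z β γ e.1.1 e.1.2

/-- `F_i(β, γ) = ∑_{j ≠ i} μ_{ij}(β, γ) - d̃_i`. -/
def F {n p : ℕ} (z : Fin n → Fin n → Fin p → ℝ) (dt : Fin n → ℝ)
    (β : Fin n → ℝ) (γ : Fin p → ℝ) (i : Fin n) : ℝ :=
  meanDegree z β γ i - dt i

/-- `Q(β, γ) = ∑_{i < j} z_{ij} μ_{ij}(β, γ) - ỹ`. -/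
def Q {n p : ℕ} (z : Fin n → Fin n → Fin p → ℝ) (yt : Fin p → ℝ)
    (β : Fin n → ℝ) (γ : Fin p → ℝ) (t : Fin p) : ℝ :=
  meanCov z β γ t - yt t

/-- `(β, γ)` solves the noisy moment equations `F(β, γ) = 0`, `Q(β, γ) = 0`. -/
def IsSolution {n p : ℕ} (z : Fin n → Fin n → Fin p → ℝ) (dt : Fin n → ℝ) (yt : Fin p → ℝ)
    (β : Fin n → ℝ) (γ : Fin p → ℝ) : Prop :=
  (∀ i, F z dt β γ i = 0) ∧ ∀ t, Q z yt β γ t = 0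

/-- The Jacobian matrix `(∂f_i / ∂x_j)` of `f` at `x`, made of partial derivatives. -/
def jac {r m : ℕ} (f : (Fin m → ℝ) → Fin r → ℝ) (x : Fin m → ℝ) : Matrix (Fin r) (Fin m) ℝ :=
  Matrix.of fun i j => deriv (fun s => f (Function.update x j s) i) (x j)

/-- `H = ∂Q/∂γ - ∂Q/∂β [∂F/∂β]⁻¹ ∂F/∂γ` at `(β, γ)`. The observed statistics enter `F` and `Q`
only as additive constants, so they are set to `0` here. -/
def H {n p : ℕ} (z : Fin n → Fin n → Fin p → ℝ) (β : Fin n → ℝ) (γ : Fin p → ℝ) :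
    Matrix (Fin p) (Fin p) ℝ :=
  jac (fun g => Q z 0 β g) γ
    - jac (fun b => Q z 0 b γ) β * (jac (fun b => F z 0 b γ) β)⁻¹ * jac (fun g => F z 0 β g) γ

/-- The matrix norm induced by the `ℓ_∞`-norm, i.e. the largest absolute row sum. -/
def rowNorm {p : ℕ} (A : Matrix (Fin p) (Fin p) ℝ) : ℝ :=
  ⨆ i, ∑ j, |A i j|

/-- `b_n`: the supremum of `(1 + e^{π_{ij}})² / e^{π_{ij}}` over `i ≠ j`, over `β` in the closed
`ℓ_∞`-ball of radius `r₁` about `βs` and over `γ` in the closed `ℓ_∞`-ball of radius `r₂` about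
`γs`. (The metric of `Fin n → ℝ` is the `ℓ_∞`-metric.) -/
def bSup {n p : ℕ} (z : Fin n → Fin n → Fin p → ℝ) (βs : Fin n → ℝ) (γs : Fin p → ℝ)
    (r₁ r₂ : ℝ) : ℝ :=
  sSup {x : ℝ | ∃ β ∈ Metric.closedBall βs r₁, ∃ γ ∈ Metric.closedBall γs r₂,
    ∃ i j : Fin n, i ≠ j ∧
      x = (1 + Real.exp (linPred z β γ i j)) ^ 2 / Real.exp (linPred z β γ i j)}

/-- `z_* = max_{i ≠ j} ‖z_{ij}‖_∞`. -/
def zStar {n p : ℕ} (z : Fin n → Fin n → Fin p → ℝ) : ℝ :=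
  ⨆ e : {e : Fin n × Fin n // e.1 ≠ e.2}, ‖z e.1.1 e.1.2‖

/-- The discrete Laplace distribution on `ℤ ⊆ ℝ`, with mass `(1 - l) / (1 + l) * l ^ |x|`
at the integer `x`. -/
def discreteLaplace (l : ℝ) : Measure ℝ :=
  Measure.sum fun x : ℤ =>
    ENNReal.ofReal ((1 - l) / (1 + l) * l ^ x.natAbs) • Measure.dirac (x : ℝ)

/-- The Laplace distribution with density `e^{-|x|/l} / (2 l)` for `l > 0`. For scale `l = 0`
(no noise) it is the point mass at `0`. -/
def laplace (l : ℝ) : Measure ℝ :=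
  if l = 0 then Measure.dirac 0
  else volume.withDensity fun x => ENNReal.ofReal (Real.exp (-|x| / l) / (2 * l))

/-- The degree `d_i = ∑_{j ≠ i} a_{ij}`. -/
def degree {n : ℕ} (a : Fin n → Fin n → ℝ) (i : Fin n) : ℝ :=
  ∑ j ∈ Finset.univ.erase i, a i j

/-- The covariate statistic `y = ∑_{i < j} z_{ij} a_{ij}`. -/
def covStat {n p : ℕ} (z : Fin n → Fin n → Fin p → ℝ) (a : Fin n → Fin n → ℝ) (t : Fin p) : ℝ :=
  ∑ e : Pair n, z e.1.1 e.1.2 t * a e.1.1 e.1.2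

/-- The adjacency matrix `a` of a random graph from the covariate-adjusted `β`-model with
parameters `(β, γ)`, the noise `ξ` (discrete Laplace with parameter `e^{-ε/(4k)}`) added to the
degrees and the noise `η` (Laplace with scale `2 p k z_* / ε`) added to the covariate statistic,
all edges and all noise variables being mutually independent. -/
structure IsNoisyNetwork {Ω : Type*} [MeasurableSpace Ω] (P : Measure Ω) {n p : ℕ}
    (z : Fin n → Fin n → Fin p → ℝ) (β : Fin n → ℝ) (γ : Fin p → ℝ) (k : ℕ) (ε : ℝ)
    (a : Ω → Fin n → Fin n → ℝ) (ξ : Ω → Fin n → ℝ) (η : Ω → Fin p → ℝ) : Prop where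
  symm : ∀ ω i j, a ω i j = a ω j i
  loopless : ∀ ω i, a ω i i = 0
  edge_law : ∀ i j, i ≠ j → HasLaw (fun ω => a ω i j)
    (bernoulliMeasure (1 : ℝ) 0 (unitInterval.sigmoid (linPred z β γ i j))) P
  degree_noise_law : ∀ i, HasLaw (fun ω => ξ ω i) (discreteLaplace (Real.exp (-(ε / (4 * k))))) P
  cov_noise_law : ∀ t, HasLaw (fun ω => η ω t) (laplace (2 * p * k * zStar z / ε)) P
  indep : iIndepFun (fun (s : Pair n ⊕ Fin n ⊕ Fin p) (ω : Ω) =>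
    match s with
    | .inl e => a ω e.1.1 e.1.2
    | .inr (.inl i) => ξ ω i
    | .inr (.inr t) => η ω t) P

/-- The released degrees `d̃ = d + ξ`. -/
def noisyDegree {n : ℕ} (a : Fin n → Fin n → ℝ) (ξ : Fin n → ℝ) (i : Fin n) : ℝ :=
  degree a i + ξ i

/-- The released covariate statistic `ỹ = y + η`. -/
def noisyCov {n p : ℕ} (z : Fin n → Fin n → Fin p → ℝ) (a : Fin n → Fin n → ℝ) (η : Fin p → ℝ)
    (t : Fin p) : ℝ :=
  covStat z a t + η t

/-- `X_n = O_p(r_n)`: for every `δ > 0` there is `M > 0` such that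
`P_n(|X_n| > M r_n) ≤ δ` for all large `n`. -/
def IsBigOp {Ω : ℕ → Type*} [∀ n, MeasurableSpace (Ω n)] (P : ∀ n, Measure (Ω n))
    (X : ∀ n, Ω n → ℝ) (r : ℕ → ℝ) : Prop :=
  ∀ δ : ℝ, 0 < δ → ∃ M : ℝ, 0 < M ∧
    ∀ᶠ n in atTop, P n {ω | M * r n < |X n ω|} ≤ ENNReal.ofReal δ

end CovBeta

end

/-! The moment equations are the stationarity equations of a convex negative log-likelihood, so
existence is obtained by minimising it over a small box around the truth and showing that the
minimiser lies in the interior. Even on the boundary, a minimiser satisfies sign conditions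
coordinate by coordinate (`exists_box_solution`).

Let `(c, u)` be the displacement of the minimiser and `S` its Fisher information (`infoForm` at the
truth). Testing the sign conditions against `(c, u)` and using monotonicity of the sigmoid leaves `S
/ 3` on one side and noise on the other. The directions form a space of dimension at most `n + p`,
so the score is at most `T √n √S` uniformly in the direction (`exists_uniform_bound`), whence `√S ≤
9 T √n` (`sqrt_infoForm_le`).

The hypothesis on `H` enters by Schur complement: each coordinate `u t` is the information pairing
of `(c, u)` with a vector `(α, h)`, where `h` is a column of `H⁻¹` (`exists_representer`).
Cauchy–Schwarz gives `‖u‖ = O(√(ρ/n))`, and solving a single degree equation for its own node bounds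
`c i` (`abs_node_le`). The rate conditions put both below the radii of the box, so the minimiser
solves the equations; strict monotonicity makes the solution unique.

A second pass gives the rates. Tested against the representer, the equations have linear part
exactly `u t`; node errors enter only through a remainder of order `S · max |linPred α h|`, which is
`O(b ζ ρ / n)` (`abs_cov_coord_le`). Put back into the row bound, this is negligible and the nodes
get `b √(log n / n)`. The noise is controlled by Markov, Chebyshev and, for the degrees, Hoeffding
with a union bound. Both `b` and `H` are needed only at the true parameters. -/

noncomputable section

/-! ### The sigmoid function and its slope. -/

namespace CovBeta

/-- The derivative `σ(x)(1 - σ(x))` of the sigmoid function. -/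
def sigmoidSlope (x : ℝ) : ℝ := Real.sigmoid x * (1 - Real.sigmoid x)

lemma sigmoidSlope_eq (x : ℝ) : sigmoidSlope x = (2 + Real.exp x + Real.exp (-x))⁻¹ := by
  have h := Real.exp_pos x
  rw [sigmoidSlope, Real.sigmoid_def, Real.exp_neg]
  field_simp
  ring

lemma sigmoidSlope_inv (x : ℝ) :
    (sigmoidSlope x)⁻¹ = (1 + Real.exp x) ^ 2 / Real.exp x := by
  have h := Real.exp_pos x
  rw [sigmoidSlope_eq, Real.exp_neg]
  field_simp
  ring

lemma sigmoidSlope_pos (x : ℝ) : 0 < sigmoidSlope x := by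
  rw [sigmoidSlope_eq]; positivity

lemma sigmoidSlope_le (x : ℝ) : sigmoidSlope x ≤ 1 / 4 := by
  rw [sigmoidSlope]
  nlinarith [sq_nonneg (Real.sigmoid x - 1 / 2)]

lemma hasDerivAt_sigmoid_slope (x : ℝ) : HasDerivAt Real.sigmoid (sigmoidSlope x) x :=
  Real.hasDerivAt_sigmoid x

/-- The inverse slope is `2 + e^x + e^{-x}`, and a shift by `s` multiplies each term by at most
`e^{|s|}`. The control is thus relative, which keeps powers of `b` out of the Taylor remainder. -/
lemma inv_sigmoidSlope_le (x y : ℝ) :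
    (sigmoidSlope y)⁻¹ ≤ Real.exp |y - x| * (sigmoidSlope x)⁻¹ := by
  simp only [sigmoidSlope_eq, inv_inv]
  have h1 : Real.exp y ≤ Real.exp |y - x| * Real.exp x := by
    rw [← Real.exp_add]; exact Real.exp_le_exp.2 (by linarith [le_abs_self (y - x)])
  have h2 : Real.exp (-y) ≤ Real.exp |y - x| * Real.exp (-x) := by
    rw [← Real.exp_add]; exact Real.exp_le_exp.2 (by linarith [neg_abs_le (y - x)])
  have h3 : 1 ≤ Real.exp |y - x| := Real.one_le_exp (abs_nonneg _)
  linarith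

lemma sigmoidSlope_le_exp_mul (x y : ℝ) :
    sigmoidSlope y ≤ Real.exp |y - x| * sigmoidSlope x := by
  have h := inv_sigmoidSlope_le y x
  have hx := sigmoidSlope_pos x
  have hy := sigmoidSlope_pos y
  rw [abs_sub_comm] at h
  rw [← div_eq_mul_inv, le_div_iff₀ hy] at h
  field_simp at h
  linarith

/-- Mean value form of the increments of the sigmoid function, with a weight comparable to the
derivative at the base point. -/
lemma exists_sigmoid_increment (x t : ℝ) (ht : |t| ≤ 1) :
    ∃ ν, Real.sigmoid (x + t) - Real.sigmoid x = ν * t ∧ sigmoidSlope x / 3 ≤ ν ∧ ν ≤ 1 / 4 ∧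
      |ν - sigmoidSlope x| ≤ 2 * sigmoidSlope x * |t| := by
  have key : ∃ y, |y - x| ≤ |t| ∧
      Real.sigmoid (x + t) - Real.sigmoid x = sigmoidSlope y * t := by
    have hcont : Continuous Real.sigmoid := continuous_sigmoid
    rcases lt_trichotomy t 0 with h | h | h
    · obtain ⟨y, hy, e⟩ := exists_hasDerivAt_eq_slope Real.sigmoid sigmoidSlope
        (show x + t < x by linarith) hcont.continuousOn fun y _ => hasDerivAt_sigmoid_slope y
      refine ⟨y, ?_, ?_⟩
      · rw [abs_of_neg h, abs_le]; constructor <;> linarith [hy.1, hy.2]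
      · rw [e]; field_simp [h.ne]; ring
    · exact ⟨x, by simp, by simp [h]⟩
    · obtain ⟨y, hy, e⟩ := exists_hasDerivAt_eq_slope Real.sigmoid sigmoidSlope
        (show x < x + t by linarith) hcont.continuousOn fun y _ => hasDerivAt_sigmoid_slope y
      refine ⟨y, ?_, ?_⟩
      · rw [abs_of_pos h, abs_le]; constructor <;> linarith [hy.1, hy.2]
      · rw [e]; field_simp [h.ne']; ring
  obtain ⟨y, hy, e⟩ := key
  have hx := sigmoidSlope_pos x
  -- From `e^s ≤ 1 + s + s²` on `[0, 1]`. As `|t| ≤ 1`, the factor is at most 3, the source of the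
  -- constant `1 / 3`.
  have hexp : Real.exp |y - x| ≤ 1 + 2 * |t| := by
    refine (Real.exp_le_exp.2 hy).trans ?_
    have h0 := abs_nonneg t
    have h1 := Real.abs_exp_sub_one_sub_id_le (x := |t|) (by rwa [abs_abs])
    have h2 := (abs_le.1 h1).2
    nlinarith
  have hyp := sigmoidSlope_pos y
  have h1 := sigmoidSlope_le_exp_mul x y
  have h2 := sigmoidSlope_le_exp_mul y x
  rw [abs_sub_comm] at h2
  have h1' : sigmoidSlope y ≤ (1 + 2 * |t|) * sigmoidSlope x :=
    h1.trans (mul_le_mul_of_nonneg_right hexp hx.le)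
  have h2' : sigmoidSlope x ≤ (1 + 2 * |t|) * sigmoidSlope y :=
    h2.trans (mul_le_mul_of_nonneg_right hexp hyp.le)
  refine ⟨sigmoidSlope y, e, by nlinarith, sigmoidSlope_le y, ?_⟩
  rw [abs_le]
  have h0 := abs_nonneg t
  refine ⟨?_, by nlinarith⟩
  -- The lower bound comes out with the slope at `y`; if that slope is the smaller one, it may be
  -- replaced by the slope at `x`.
  rcases le_total (sigmoidSlope y) (sigmoidSlope x) with h | h <;> nlinarith [mul_le_mul_of_nonneg_left h h0]

lemma hasDerivAt_log_one_add_exp (x : ℝ) :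
    HasDerivAt (fun x => Real.log (1 + Real.exp x)) (Real.sigmoid x) x := by
  have h := ((Real.hasDerivAt_exp x).const_add 1).log (by positivity)
  convert! h using 1
  have h := Real.exp_pos x
  rw [Real.sigmoid_def, Real.exp_neg]
  field_simp
  ring

/-! ### Sums over unordered pairs of nodes. -/

section PairSums
variable {n : ℕ}

lemma sum_erase_eq_sum_pair (g : Fin n → Fin n → ℝ) :
    ∑ i, ∑ j ∈ Finset.univ.erase i, g i j = ∑ e : Pair n, (g e.1.1 e.1.2 + g e.1.2 e.1.1) := by
  classical
  have h1 : ∑ i, ∑ j ∈ Finset.univ.erase i, g i j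
      = ∑ x : Fin n × Fin n, if x.1 ≠ x.2 then g x.1 x.2 else 0 := by
    rw [Fintype.sum_prod_type]
    refine Finset.sum_congr rfl fun i _ => ?_
    rw [← Finset.sum_filter]
    refine Finset.sum_congr ?_ fun _ _ => rfl
    ext j; simp [eq_comm]
  have h2 : ∀ f : Fin n → Fin n → ℝ, ∑ e : Pair n, f e.1.1 e.1.2
      = ∑ x : Fin n × Fin n, if x.1 < x.2 then f x.1 x.2 else 0 := by
    intro f
    rw [← Finset.sum_filter]
    exact (Finset.sum_subtype (Finset.univ.filter fun x : Fin n × Fin n => x.1 < x.2)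
      (by simp) (fun x => f x.1 x.2)).symm
  have h3 : ∑ x : Fin n × Fin n, (if x.1 < x.2 then g x.2 x.1 else 0)
      = ∑ x : Fin n × Fin n, if x.2 < x.1 then g x.1 x.2 else 0 :=
    Fintype.sum_equiv (Equiv.prodComm _ _) _ _ fun x => rfl
  rw [h1, Finset.sum_add_distrib, h2 fun i j => g i j, h2 fun i j => g j i, h3,
    ← Finset.sum_add_distrib]
  refine Finset.sum_congr rfl fun x _ => ?_
  rcases lt_trichotomy x.1 x.2 with h | h | h
  · simp [h, h.ne, h.not_gt]
  · simp [h]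
  · simp [h, h.ne', h.not_gt]

lemma sum_mul_sum_erase (c : Fin n → ℝ) (g : Fin n → Fin n → ℝ) (hg : ∀ i j, g i j = g j i) :
    ∑ i, c i * ∑ j ∈ Finset.univ.erase i, g i j
      = ∑ e : Pair n, g e.1.1 e.1.2 * (c e.1.1 + c e.1.2) := by
  simp_rw [Finset.mul_sum]
  rw [sum_erase_eq_sum_pair fun i j => c i * g i j]
  refine Finset.sum_congr rfl fun e _ => ?_
  rw [hg e.1.2 e.1.1]; ring

lemma two_mul_card_pair : 2 * (Fintype.card (Pair n) : ℝ) = n * (n - 1) := by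
  have h := sum_erase_eq_sum_pair (n := n) fun _ _ => (1 : ℝ)
  simp only [Finset.sum_const, Finset.card_univ, nsmul_eq_mul, Fintype.card_fin,
    Finset.card_erase_of_mem (Finset.mem_univ _), mul_one] at h
  rcases Nat.eq_zero_or_pos n with rfl | hn
  · norm_num at h ⊢
  · rw [Nat.cast_sub hn] at h
    push_cast at h
    linarith

/-- The signless Laplacian of the complete graph is bounded below by `n - 2`. -/
lemma sum_sq_le_sum_pair (c : Fin n → ℝ) :
    ((n : ℝ) - 2) * ∑ i, c i ^ 2 ≤ ∑ e : Pair n, (c e.1.1 + c e.1.2) ^ 2 := by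
  have h := sum_erase_eq_sum_pair (n := n) fun i j => (c i + c j) ^ 2
  have h1 : ∑ i, ∑ j ∈ Finset.univ.erase i, (c i + c j) ^ 2
      = 2 * ((n : ℝ) - 2) * ∑ i, c i ^ 2 + 2 * (∑ i, c i) ^ 2 := by
    have : ∀ i, ∑ j ∈ Finset.univ.erase i, (c i + c j) ^ 2
        = n * c i ^ 2 + 2 * c i * (∑ j, c j) + (∑ j, c j ^ 2) - 4 * c i ^ 2 := by
      intro i
      have := Finset.sum_erase_eq_sub (f := fun j => (c i + c j) ^ 2) (Finset.mem_univ i)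
      rw [this]
      have e : ∀ j, (c i + c j) ^ 2 = c i ^ 2 + 2 * c i * c j + c j ^ 2 := fun j => by ring
      simp_rw [e, Finset.sum_add_distrib, ← Finset.mul_sum]
      simp
      ring
    simp_rw [this, Finset.sum_sub_distrib, Finset.sum_add_distrib, ← Finset.mul_sum,
      ← Finset.sum_mul, ← Finset.mul_sum]
    simp
    ring
  have h2 : ∑ e : Pair n, ((c e.1.1 + c e.1.2) ^ 2 + (c e.1.2 + c e.1.1) ^ 2)
      = 2 * ∑ e : Pair n, (c e.1.1 + c e.1.2) ^ 2 := by
    rw [Finset.mul_sum]; exact Finset.sum_congr rfl fun e _ => by ring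
  -- The ordered sum equals `2 (n - 2) ∑ c² + 2 (∑ c)²`; the second square is dropped.
  rw [h1, h2] at h
  nlinarith [sq_nonneg (∑ i, c i)]

end PairSums

/-! ### Linearity and size of the linear predictor. -/

section LinPred
variable {n p : ℕ} {z : Fin n → Fin n → Fin p → ℝ}

lemma linPred_add (c c' : Fin n → ℝ) (u u' : Fin p → ℝ) (i j : Fin n) :
    linPred z (c + c') (u + u') i j = linPred z c u i j + linPred z c' u' i j := by
  simp only [linPred, Pi.add_apply, mul_add, Finset.sum_add_distrib]; ring

lemma linPred_smul (r : ℝ) (c : Fin n → ℝ) (u : Fin p → ℝ) (i j : Fin n) :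
    linPred z (r • c) (r • u) i j = r * linPred z c u i j := by
  simp only [linPred, Pi.smul_apply, smul_eq_mul, mul_add, Finset.mul_sum]
  congr 1
  exact Finset.sum_congr rfl fun t _ => by ring

lemma linPred_sub (c c' : Fin n → ℝ) (u u' : Fin p → ℝ) (i j : Fin n) :
    linPred z (c - c') (u - u') i j = linPred z c u i j - linPred z c' u' i j := by
  simp only [linPred, Pi.sub_apply, mul_sub, Finset.sum_sub_distrib]; ring

lemma linPred_comm (hz : ∀ i j, z i j = z j i) (c : Fin n → ℝ) (u : Fin p → ℝ) (i j : Fin n) :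
    linPred z c u i j = linPred z c u j i := by
  simp only [linPred, hz i j]; ring

lemma linPred_zero_right (c : Fin n → ℝ) (i j : Fin n) : linPred z c 0 i j = c i + c j := by
  simp [linPred]

lemma norm_le_zStar {i j : Fin n} (h : i ≠ j) : ‖z i j‖ ≤ zStar z :=
  le_ciSup (f := fun e : {e : Fin n × Fin n // e.1 ≠ e.2} => ‖z e.1.1 e.1.2‖)
    (Set.finite_range _).bddAbove ⟨(i, j), h⟩

lemma zStar_nonneg : 0 ≤ zStar z := Real.iSup_nonneg fun _ => norm_nonneg _

lemma abs_sum_mul_le {i j : Fin n} (h : i ≠ j) (u : Fin p → ℝ) :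
    |∑ t, z i j t * u t| ≤ p * zStar z * ‖u‖ := by
  calc |∑ t, z i j t * u t| ≤ ∑ t, |z i j t * u t| := Finset.abs_sum_le_sum_abs _ _
    _ ≤ ∑ _t : Fin p, zStar z * ‖u‖ := by
      refine Finset.sum_le_sum fun t _ => ?_
      rw [abs_mul]
      exact mul_le_mul ((norm_le_pi_norm (z i j) t).trans (norm_le_zStar h))
        (norm_le_pi_norm u t) (abs_nonneg _) zStar_nonneg
    _ = p * zStar z * ‖u‖ := by simp; ring

lemma abs_linPred_le {i j : Fin n} (h : i ≠ j) (c : Fin n → ℝ) (u : Fin p → ℝ) :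
    |linPred z c u i j| ≤ 2 * ‖c‖ + p * zStar z * ‖u‖ := by
  have h1 : |c i| ≤ ‖c‖ := norm_le_pi_norm c i
  have h2 : |c j| ≤ ‖c‖ := norm_le_pi_norm c j
  have h3 := abs_sum_mul_le (z := z) h u
  calc |linPred z c u i j| ≤ |c i| + |c j| + |∑ t, z i j t * u t| := abs_add_three _ _ _
    _ ≤ _ := by linarith

end LinPred

/-! ### Jacobians of the moment equations, and the representers obtained from `H⁻¹`. -/

/-- The derivative of `μ_{ij}` with respect to `π_{ij}`. -/
def edgeVar {n p : ℕ} (z : Fin n → Fin n → Fin p → ℝ) (β : Fin n → ℝ) (γ : Fin p → ℝ)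
    (i j : Fin n) : ℝ :=
  sigmoidSlope (linPred z β γ i j)

section Jacobian
variable {n p : ℕ} {z : Fin n → Fin n → Fin p → ℝ}

lemma edgeVar_comm (hz : ∀ i j, z i j = z j i) (β : Fin n → ℝ) (γ : Fin p → ℝ) (i j : Fin n) :
    edgeVar z β γ i j = edgeVar z β γ j i := by
  rw [edgeVar, linPred_comm hz, edgeVar]

lemma edgeVar_pos (β : Fin n → ℝ) (γ : Fin p → ℝ) (i j : Fin n) : 0 < edgeVar z β γ i j :=
  sigmoidSlope_pos _

/-- Writing the partial derivative through `linPred` of a basis vector lets linearity reassemble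
`linPred z c 0` when the Jacobian acts on `c`. -/
lemma hasDerivAt_edgeProb_left (β : Fin n → ℝ) (γ : Fin p → ℝ) (i j k : Fin n) :
    HasDerivAt (fun s => edgeProb z (Function.update β k s) γ i j)
      (edgeVar z β γ i j * linPred z (Pi.single k 1) 0 i j) (β k) := by
  have h1 : ∀ s, linPred z (Function.update β k s) γ i j
      = linPred z β γ i j + (s - β k) * linPred z (Pi.single k 1) 0 i j := by
    intro s
    rw [← linPred_smul, ← linPred_add]
    congr 1
    · ext l
      by_cases h : l = k
      · subst h; simp
      · simp [h]
    · simp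
  have h2 : HasDerivAt (fun s => linPred z (Function.update β k s) γ i j)
      (linPred z (Pi.single k 1) 0 i j) (β k) := by
    simp_rw [h1]
    simpa using ((((hasDerivAt_id (β k)).sub_const (β k)).mul_const
      (linPred z (Pi.single k 1) 0 i j)).const_add (linPred z β γ i j))
  have h3 := hasDerivAt_sigmoid_slope (linPred z (Function.update β k (β k)) γ i j)
  have h4 := HasDerivAt.comp (β k) h3 h2
  simpa [edgeVar] using! h4

lemma hasDerivAt_edgeProb_right (β : Fin n → ℝ) (γ : Fin p → ℝ) (i j : Fin n) (t : Fin p) :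
    HasDerivAt (fun s => edgeProb z β (Function.update γ t s) i j)
      (edgeVar z β γ i j * linPred z 0 (Pi.single t 1) i j) (γ t) := by
  have h1 : ∀ s, linPred z β (Function.update γ t s) i j
      = linPred z β γ i j + (s - γ t) * linPred z 0 (Pi.single t 1) i j := by
    intro s
    rw [← linPred_smul, ← linPred_add]
    congr 1
    · simp
    · ext l
      by_cases h : l = t
      · subst h; simp
      · simp [h]
  have h2 : HasDerivAt (fun s => linPred z β (Function.update γ t s) i j)
      (linPred z 0 (Pi.single t 1) i j) (γ t) := by
    simp_rw [h1]
    simpa using ((((hasDerivAt_id (γ t)).sub_const (γ t)).mul_const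
      (linPred z 0 (Pi.single t 1) i j)).const_add (linPred z β γ i j))
  have h3 := hasDerivAt_sigmoid_slope (linPred z β (Function.update γ t (γ t)) i j)
  have h4 := HasDerivAt.comp (γ t) h3 h2
  simpa [edgeVar] using! h4

lemma sum_linPred_single_left_mul (c : Fin n → ℝ) (i j : Fin n) :
    ∑ k, linPred z (Pi.single k 1) 0 i j * c k = linPred z c 0 i j := by
  simp [linPred, Pi.single_apply, add_mul, Finset.sum_add_distrib]

lemma sum_linPred_single_right_mul (u : Fin p → ℝ) (i j : Fin n) :
    ∑ t, linPred z 0 (Pi.single t 1) i j * u t = linPred z 0 u i j := by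
  simp [linPred, Pi.single_apply]

/-- The Jacobians are used only through their action on vectors, so no case split between diagonal
and off-diagonal entries is needed. -/
lemma jac_F_left_mulVec (β : Fin n → ℝ) (γ : Fin p → ℝ) (c : Fin n → ℝ) (i : Fin n) :
    (jac (fun b => F z 0 b γ) β).mulVec c i
      = ∑ j ∈ Finset.univ.erase i, edgeVar z β γ i j * linPred z c 0 i j := by
  have h : ∀ k, jac (fun b => F z 0 b γ) β i k
      = ∑ j ∈ Finset.univ.erase i, edgeVar z β γ i j * linPred z (Pi.single k 1) 0 i j := by
    intro k
    have := (HasDerivAt.fun_sum (u := Finset.univ.erase i)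
      fun j _ => hasDerivAt_edgeProb_left (z := z) β γ i j k).sub_const ((0 : Fin n → ℝ) i)
    exact this.deriv
  simp_rw [Matrix.mulVec, dotProduct, h, Finset.sum_mul]
  rw [Finset.sum_comm]
  simp_rw [mul_assoc, ← Finset.mul_sum, sum_linPred_single_left_mul]

lemma jac_F_right_mulVec (β : Fin n → ℝ) (γ : Fin p → ℝ) (u : Fin p → ℝ) (i : Fin n) :
    (jac (fun g => F z 0 β g) γ).mulVec u i
      = ∑ j ∈ Finset.univ.erase i, edgeVar z β γ i j * linPred z 0 u i j := by
  have h : ∀ t, jac (fun g => F z 0 β g) γ i t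
      = ∑ j ∈ Finset.univ.erase i, edgeVar z β γ i j * linPred z 0 (Pi.single t 1) i j := by
    intro t
    have := (HasDerivAt.fun_sum (u := Finset.univ.erase i)
      fun j _ => hasDerivAt_edgeProb_right (z := z) β γ i j t).sub_const ((0 : Fin n → ℝ) i)
    exact this.deriv
  simp_rw [Matrix.mulVec, dotProduct, h, Finset.sum_mul]
  rw [Finset.sum_comm]
  simp_rw [mul_assoc, ← Finset.mul_sum, sum_linPred_single_right_mul]

lemma jac_Q_left_mulVec (β : Fin n → ℝ) (γ : Fin p → ℝ) (c : Fin n → ℝ) (s : Fin p) :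
    (jac (fun b => Q z 0 b γ) β).mulVec c s
      = ∑ e : Pair n, z e.1.1 e.1.2 s *
        (edgeVar z β γ e.1.1 e.1.2 * linPred z c 0 e.1.1 e.1.2) := by
  have h : ∀ k, jac (fun b => Q z 0 b γ) β s k = ∑ e : Pair n, z e.1.1 e.1.2 s *
        (edgeVar z β γ e.1.1 e.1.2 * linPred z (Pi.single k 1) 0 e.1.1 e.1.2) := by
    intro k
    have := (HasDerivAt.fun_sum (u := Finset.univ) fun (e : Pair n) _ =>
      (hasDerivAt_edgeProb_left (z := z) β γ e.1.1 e.1.2 k).const_mul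
        (z e.1.1 e.1.2 s)).sub_const ((0 : Fin p → ℝ) s)
    exact this.deriv
  simp_rw [Matrix.mulVec, dotProduct, h, Finset.sum_mul]
  rw [Finset.sum_comm]
  simp_rw [mul_assoc, ← Finset.mul_sum, sum_linPred_single_left_mul]

lemma jac_Q_right_mulVec (β : Fin n → ℝ) (γ : Fin p → ℝ) (u : Fin p → ℝ) (s : Fin p) :
    (jac (fun g => Q z 0 β g) γ).mulVec u s
      = ∑ e : Pair n, z e.1.1 e.1.2 s *
        (edgeVar z β γ e.1.1 e.1.2 * linPred z 0 u e.1.1 e.1.2) := by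
  have h : ∀ t, jac (fun g => Q z 0 β g) γ s t = ∑ e : Pair n, z e.1.1 e.1.2 s *
        (edgeVar z β γ e.1.1 e.1.2 * linPred z 0 (Pi.single t 1) e.1.1 e.1.2) := by
    intro t
    have := (HasDerivAt.fun_sum (u := Finset.univ) fun (e : Pair n) _ =>
      (hasDerivAt_edgeProb_right (z := z) β γ e.1.1 e.1.2 t).const_mul
        (z e.1.1 e.1.2 s)).sub_const ((0 : Fin p → ℝ) s)
    exact this.deriv
  simp_rw [Matrix.mulVec, dotProduct, h, Finset.sum_mul]
  rw [Finset.sum_comm]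
  simp_rw [mul_assoc, ← Finset.mul_sum, sum_linPred_single_right_mul]

/-- Summation by parts of the equations of a weighted system over nodes and covariates. -/
lemma sum_pair_mul_linPred {f : Fin n → Fin n → ℝ} (hf : ∀ i j, f i j = f j i)
    (c : Fin n → ℝ) (u : Fin p → ℝ) :
    ∑ e : Pair n, f e.1.1 e.1.2 * linPred z c u e.1.1 e.1.2
      = ∑ i, c i * ∑ j ∈ Finset.univ.erase i, f i j
        + ∑ t, u t * ∑ e : Pair n, z e.1.1 e.1.2 t * f e.1.1 e.1.2 := by
  rw [sum_mul_sum_erase c f hf]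
  simp_rw [Finset.mul_sum (s := (Finset.univ : Finset (Pair n)))]
  rw [Finset.sum_comm, ← Finset.sum_add_distrib]
  refine Finset.sum_congr rfl fun e _ => ?_
  rw [linPred, mul_add, Finset.mul_sum]
  congr 1
  exact Finset.sum_congr rfl fun t _ => by ring

/-- A kernel vector `c`, paired with its own image, makes `∑ edgeVar · (c i + c j)²` vanish. The
weights are positive, so every `c i + c j` is zero, and the bound by `n - 2 > 0` forces `c = 0`. -/
lemma isUnit_det_jac_F (hz : ∀ i j, z i j = z j i) (hn : 3 ≤ n) (β : Fin n → ℝ)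
    (γ : Fin p → ℝ) : IsUnit (jac (fun b => F z 0 b γ) β).det := by
  rw [← Matrix.isUnit_iff_isUnit_det, ← Matrix.mulVec_injective_iff_isUnit]
  refine (injective_iff_map_eq_zero (Matrix.mulVecLin _)).2 fun c hc => ?_
  have h0 : ∀ i, ∑ j ∈ Finset.univ.erase i, edgeVar z β γ i j * linPred z c 0 i j = 0 := by
    intro i
    rw [← jac_F_left_mulVec]
    exact congrFun hc i
  have h1 := sum_pair_mul_linPred (z := z)
    (f := fun i j => edgeVar z β γ i j * linPred z c 0 i j)
    (fun i j => by rw [edgeVar_comm hz, linPred_comm hz]) c 0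
  simp only [h0, mul_zero, Finset.sum_const_zero, Pi.zero_apply, zero_mul, add_zero] at h1
  have h2 : ∀ e : Pair n, linPred z c 0 e.1.1 e.1.2 = 0 := by
    rw [Finset.sum_eq_zero_iff_of_nonneg] at h1
    · intro e
      have := h1 e (Finset.mem_univ e)
      simpa [(edgeVar_pos (z := z) β γ e.1.1 e.1.2).ne'] using this
    · intro e _
      rw [mul_assoc]
      exact mul_nonneg (edgeVar_pos ..).le (mul_self_nonneg _)
  have h3 := sum_sq_le_sum_pair c
  simp_rw [linPred_zero_right] at h2
  simp only [h2, ne_eq, OfNat.ofNat_ne_zero, not_false_eq_true, zero_pow,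
    Finset.sum_const_zero] at h3
  have hn' : (0 : ℝ) < n - 2 := by
    have : (3 : ℝ) ≤ n := by exact_mod_cast hn
    linarith
  have h4 : ∑ i, c i ^ 2 = 0 :=
    le_antisymm (nonpos_of_mul_nonpos_right h3 hn') (Finset.sum_nonneg fun _ _ => sq_nonneg _)
  rw [Finset.sum_eq_zero_iff_of_nonneg fun _ _ => sq_nonneg _] at h4
  ext i
  simpa using h4 i (Finset.mem_univ i)

lemma abs_le_rowNorm (A : Matrix (Fin p) (Fin p) ℝ) (i j : Fin p) : |A i j| ≤ rowNorm A :=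
  (Finset.single_le_sum (f := fun j => |A i j|) (fun _ _ => abs_nonneg _)
    (Finset.mem_univ j)).trans
      (le_ciSup (f := fun i => ∑ j, |A i j|) (Set.finite_range _).bddAbove i)

lemma rowNorm_nonneg (A : Matrix (Fin p) (Fin p) ℝ) : 0 ≤ rowNorm A :=
  Real.iSup_nonneg fun _ => Finset.sum_nonneg fun _ _ => abs_nonneg _

/-- If `H` is invertible, every coordinate of `γ` is represented, with respect to the inner product
weighted by the edge variances, by a vector whose covariate part is a column of `H⁻¹`. -/
lemma exists_representer (hz : ∀ i j, z i j = z j i) (hn : 3 ≤ n) (β : Fin n → ℝ)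
    (γ : Fin p → ℝ) (hH : IsUnit (H z β γ).det) (t : Fin p) :
    ∃ (α : Fin n → ℝ) (h : Fin p → ℝ), ‖h‖ ≤ rowNorm (H z β γ)⁻¹ ∧
      (∀ i, ∑ j ∈ Finset.univ.erase i, edgeVar z β γ i j * linPred z α h i j = 0) ∧
      ∀ (c : Fin n → ℝ) (u : Fin p → ℝ), ∑ e : Pair n, edgeVar z β γ e.1.1 e.1.2 *
        linPred z α h e.1.1 e.1.2 * linPred z c u e.1.1 e.1.2 = u t := by
  set Fb := jac (fun b => F z 0 b γ) β with hFb
  set Fg := jac (fun g => F z 0 β g) γ with hFg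
  set Qb := jac (fun b => Q z 0 b γ) β with hQb
  set Qg := jac (fun g => Q z 0 β g) γ with hQg
  have hU : IsUnit Fb.det := isUnit_det_jac_F hz hn β γ
  -- Block elimination: `(α, h)` solves the full linear system with right-hand side zero on the
  -- nodes and the `t`-th unit vector on the covariates. `H` is the Schur complement of the node
  -- block.
  set h : Fin p → ℝ := (H z β γ)⁻¹.mulVec (Pi.single t 1) with hh
  set α : Fin n → ℝ := -(Fb⁻¹.mulVec (Fg.mulVec h)) with hα
  have hsplit : ∀ i j, linPred z α h i j = linPred z α 0 i j + linPred z 0 h i j := by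
    intro i j; rw [← linPred_add]; simp
  have e1 : Fb.mulVec α + Fg.mulVec h = 0 := by
    rw [hα, Matrix.mulVec_neg, Matrix.mulVec_mulVec, Matrix.mul_nonsing_inv _ hU,
      Matrix.one_mulVec, neg_add_cancel]
  have e2 : Qb.mulVec α + Qg.mulVec h = Pi.single t 1 := by
    have : (H z β γ).mulVec h = Pi.single t 1 := by
      rw [hh, Matrix.mulVec_mulVec, Matrix.mul_nonsing_inv _ hH, Matrix.one_mulVec]
    rw [← this, H, Matrix.sub_mulVec, hα, Matrix.mulVec_neg, ← Matrix.mulVec_mulVec,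
      ← Matrix.mulVec_mulVec]
    abel
  have f1 : ∀ i, ∑ j ∈ Finset.univ.erase i, edgeVar z β γ i j * linPred z α h i j = 0 := by
    intro i
    have := congrFun e1 i
    rw [Pi.add_apply, jac_F_left_mulVec, jac_F_right_mulVec, ← Finset.sum_add_distrib] at this
    simpa only [← mul_add, ← hsplit, Pi.zero_apply] using this
  have f2 : ∀ s, ∑ e : Pair n, z e.1.1 e.1.2 s *
      (edgeVar z β γ e.1.1 e.1.2 * linPred z α h e.1.1 e.1.2) = (Pi.single t 1 : Fin p → ℝ) s := by
    intro s
    have := congrFun e2 s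
    rw [Pi.add_apply, jac_Q_left_mulVec, jac_Q_right_mulVec, ← Finset.sum_add_distrib] at this
    simpa only [← mul_add, ← hsplit] using this
  refine ⟨α, h, ?_, f1, fun c u => ?_⟩
  · refine (pi_norm_le_iff_of_nonneg (rowNorm_nonneg _)).2 fun s => ?_
    rw [hh, Matrix.mulVec_single_one, Matrix.col_apply, Real.norm_eq_abs]
    exact abs_le_rowNorm _ s t
  · rw [sum_pair_mul_linPred (z := z) (f := fun i j => edgeVar z β γ i j * linPred z α h i j)
      (fun i j => by rw [edgeVar_comm hz, linPred_comm hz]) c u]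
    simp [f1, f2, Pi.single_apply]

end Jacobian

/-! ### Estimates by the information form. -/

/-- The quadratic form of the Fisher information matrix at `(β, γ)`. -/
def infoForm {n p : ℕ} (z : Fin n → Fin n → Fin p → ℝ) (β : Fin n → ℝ) (γ : Fin p → ℝ)
    (c : Fin n → ℝ) (u : Fin p → ℝ) : ℝ :=
  ∑ e : Pair n, edgeVar z β γ e.1.1 e.1.2 * linPred z c u e.1.1 e.1.2 ^ 2

section Bounds
variable {n p : ℕ} {z : Fin n → Fin n → Fin p → ℝ} {β : Fin n → ℝ} {γ : Fin p → ℝ}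

lemma infoForm_nonneg (c : Fin n → ℝ) (u : Fin p → ℝ) : 0 ≤ infoForm z β γ c u :=
  Finset.sum_nonneg fun _ _ => mul_nonneg (edgeVar_pos ..).le (sq_nonneg _)

lemma sq_sum_mul_le_infoForm (c c' : Fin n → ℝ) (u u' : Fin p → ℝ) :
    (∑ e : Pair n, edgeVar z β γ e.1.1 e.1.2 *
      linPred z c u e.1.1 e.1.2 * linPred z c' u' e.1.1 e.1.2) ^ 2
      ≤ infoForm z β γ c u * infoForm z β γ c' u' := by
  refine Finset.sum_sq_le_sum_mul_sum_of_sq_le_mul _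
    (fun e _ => mul_nonneg (edgeVar_pos ..).le (sq_nonneg _))
    (fun e _ => mul_nonneg (edgeVar_pos ..).le (sq_nonneg _)) fun e _ => le_of_eq ?_
  ring

/-- `c i + c j` is the predictor minus the covariate part, and the edge weights are at least `1 /
b`. The signless Laplacian bound then controls `∑ c²`, with `n - 2 ≥ n / 2` from `4 ≤ n`. -/
lemma sum_sq_le_infoForm {b K : ℝ} (hn : 4 ≤ n)
    (hb : ∀ i j, i ≠ j → (edgeVar z β γ i j)⁻¹ ≤ b) (c : Fin n → ℝ) (u : Fin p → ℝ)
    (hK : ∀ i j, i ≠ j → |∑ t, z i j t * u t| ≤ K) :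
    ∑ i, c i ^ 2 ≤ 4 * b * infoForm z β γ c u / n + 2 * n * K ^ 2 := by
  have hn' : (4 : ℝ) ≤ n := by exact_mod_cast hn
  have h1 : ∀ e : Pair n, (c e.1.1 + c e.1.2) ^ 2
      ≤ 2 * b * (edgeVar z β γ e.1.1 e.1.2 * linPred z c u e.1.1 e.1.2 ^ 2) + 2 * K ^ 2 := by
    intro e
    have hv := edgeVar_pos (z := z) β γ e.1.1 e.1.2
    have h2 := hb _ _ e.2.ne
    have h3 := sq_le_sq' (abs_le.1 (hK _ _ e.2.ne)).1 (abs_le.1 (hK _ _ e.2.ne)).2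
    have h4 : 1 ≤ b * edgeVar z β γ e.1.1 e.1.2 := by
      rwa [inv_eq_one_div, div_le_iff₀ hv] at h2
    have h5 : linPred z c u e.1.1 e.1.2 ^ 2
        ≤ b * edgeVar z β γ e.1.1 e.1.2 * linPred z c u e.1.1 e.1.2 ^ 2 :=
      le_mul_of_one_le_left (sq_nonneg _) h4
    have h6 : c e.1.1 + c e.1.2
        = linPred z c u e.1.1 e.1.2 - ∑ t, z e.1.1 e.1.2 t * u t := by simp [linPred]
    rw [h6]
    nlinarith [sq_nonneg (linPred z c u e.1.1 e.1.2 + ∑ t, z e.1.1 e.1.2 t * u t)]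
  have h2 := (sum_sq_le_sum_pair c).trans (Finset.sum_le_sum fun e _ => h1 e)
  rw [Finset.sum_add_distrib, ← Finset.mul_sum, ← infoForm] at h2
  simp only [Finset.sum_const, Finset.card_univ, nsmul_eq_mul] at h2
  have h3 := two_mul_card_pair (n := n)
  have h4 : 0 ≤ ∑ i, c i ^ 2 := Finset.sum_nonneg fun _ _ => sq_nonneg _
  have h5 : (n : ℝ) / 2 * ∑ i, c i ^ 2 ≤ 2 * b * infoForm z β γ c u + n ^ 2 * K ^ 2 := by
    have : (Fintype.card (Pair n) : ℝ) * (2 * K ^ 2) ≤ n ^ 2 * K ^ 2 := by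
      rw [← mul_assoc, mul_comm _ (2 : ℝ), h3]
      nlinarith [sq_nonneg K]
    nlinarith
  have h6 : 4 * b * infoForm z β γ c u / n + 2 * n * K ^ 2
      = (2 * b * infoForm z β γ c u + n ^ 2 * K ^ 2) / (n / 2) := by
    field_simp
    ring
  rw [h6, le_div_iff₀ (by positivity)]
  linarith

/-- The row is solved for `c i`, whose total weight `V` is at least `n / (6 b)`; the other nodes
enter by Cauchy–Schwarz through the `ℓ²`-norm. Only a sign condition is assumed, so that a box
minimiser on the boundary is covered. -/
lemma abs_le_of_row {b K N : ℝ} (hn : 2 ≤ n) (hb0 : 0 < b) (i : Fin n) (ν : Fin n → ℝ)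
    (hν : ∀ j, j ≠ i → 1 / (3 * b) ≤ ν j) (hν' : ∀ j, j ≠ i → ν j ≤ 1 / 4)
    (c : Fin n → ℝ) (u : Fin p → ℝ) (hK : ∀ j, j ≠ i → |∑ t, z i j t * u t| ≤ K)
    (hrow : (∑ j ∈ Finset.univ.erase i, ν j * linPred z c u i j - N) * c i ≤ 0) :
    |c i| ≤ 6 * b * |N| / n + 2 * Real.sqrt (b / n) * Real.sqrt (∑ j, c j ^ 2) + K := by
  have hn' : (2 : ℝ) ≤ n := by exact_mod_cast hn
  have hν0 : ∀ j ∈ Finset.univ.erase i, 0 ≤ ν j := fun j hj =>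
    (by positivity : (0 : ℝ) ≤ 1 / (3 * b)).trans (hν j (Finset.ne_of_mem_erase hj))
  have hK0 : 0 ≤ K := by
    have : Nontrivial (Fin n) := Fin.nontrivial_iff_two_le.2 hn
    obtain ⟨j, hj⟩ := exists_ne i
    exact (abs_nonneg _).trans (hK j hj)
  set V := ∑ j ∈ Finset.univ.erase i, ν j with hV
  set A := Real.sqrt (∑ j, c j ^ 2) with hA
  have hVlow : (n : ℝ) / (6 * b) ≤ V := by
    have h1 : ∑ _j ∈ Finset.univ.erase i, 1 / (3 * b) ≤ V :=
      Finset.sum_le_sum fun j hj => hν j (Finset.ne_of_mem_erase hj)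
    rw [Finset.sum_const, Finset.card_erase_of_mem (Finset.mem_univ _), Finset.card_univ,
      Fintype.card_fin, nsmul_eq_mul, Nat.cast_sub (by omega)] at h1
    refine le_trans ?_ h1
    rw [mul_one_div, div_le_div_iff₀ (by positivity) (by positivity)]
    push_cast
    nlinarith
  have hVpos : 0 < V := lt_of_lt_of_le (by positivity) hVlow
  have hcs : ∑ j ∈ Finset.univ.erase i, ν j * |c j| ≤ Real.sqrt V * (A / 2) := by
    have h1 : (∑ j ∈ Finset.univ.erase i, ν j * |c j|) ^ 2
        ≤ V * ∑ j ∈ Finset.univ.erase i, ν j * c j ^ 2 := by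
      refine Finset.sum_sq_le_sum_mul_sum_of_sq_le_mul _ hν0
        (fun j hj => mul_nonneg (hν0 j hj) (sq_nonneg _)) fun j _ => le_of_eq ?_
      rw [mul_pow, sq_abs]; ring
    have h2 : ∑ j ∈ Finset.univ.erase i, ν j * c j ^ 2 ≤ (A / 2) ^ 2 := by
      rw [div_pow, hA, Real.sq_sqrt (Finset.sum_nonneg fun _ _ => sq_nonneg _)]
      calc ∑ j ∈ Finset.univ.erase i, ν j * c j ^ 2
          ≤ ∑ j ∈ Finset.univ.erase i, 1 / 4 * c j ^ 2 := Finset.sum_le_sum fun j hj =>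
            mul_le_mul_of_nonneg_right (hν' j (Finset.ne_of_mem_erase hj)) (sq_nonneg _)
        _ ≤ ∑ j, 1 / 4 * c j ^ 2 := Finset.sum_le_sum_of_subset_of_nonneg
            (Finset.erase_subset _ _) fun _ _ _ => by positivity
        _ = (∑ j, c j ^ 2) / 2 ^ 2 := by rw [← Finset.mul_sum]; ring
    refine abs_le_of_sq_le_sq' ?_ (by positivity) |>.2
    rw [mul_pow, Real.sq_sqrt hVpos.le]
    exact h1.trans (mul_le_mul_of_nonneg_left h2 hVpos.le)
  have hsum : ∑ j ∈ Finset.univ.erase i, ν j * linPred z c u i j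
      = V * c i + ∑ j ∈ Finset.univ.erase i, ν j * (c j + ∑ t, z i j t * u t) := by
    rw [hV, Finset.sum_mul, ← Finset.sum_add_distrib]
    exact Finset.sum_congr rfl fun j _ => by rw [linPred]; ring
  have hrest : |∑ j ∈ Finset.univ.erase i, ν j * (c j + ∑ t, z i j t * u t)|
      ≤ Real.sqrt V * (A / 2) + V * K := by
    calc |∑ j ∈ Finset.univ.erase i, ν j * (c j + ∑ t, z i j t * u t)|
        ≤ ∑ j ∈ Finset.univ.erase i, |ν j * (c j + ∑ t, z i j t * u t)| :=
          Finset.abs_sum_le_sum_abs _ _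
      _ ≤ ∑ j ∈ Finset.univ.erase i, (ν j * |c j| + ν j * K) := by
          refine Finset.sum_le_sum fun j hj => ?_
          rw [abs_mul, abs_of_nonneg (hν0 j hj), ← mul_add]
          refine mul_le_mul_of_nonneg_left ((abs_add_le _ _).trans ?_) (hν0 j hj)
          linarith [hK j (Finset.ne_of_mem_erase hj)]
      _ ≤ _ := by rw [Finset.sum_add_distrib, ← Finset.sum_mul]; linarith
  have hmain : V * |c i| ≤ |N| + (Real.sqrt V * (A / 2) + V * K) := by
    rw [hsum] at hrow
    rcases eq_or_ne (c i) 0 with h0 | h0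
    · rw [h0, abs_zero, mul_zero]; positivity
    have hpos : 0 < |c i| := abs_pos.2 h0
    refine le_of_mul_le_mul_right ?_ hpos
    have h1 : V * |c i| * |c i| = V * c i * c i := by
      rw [mul_assoc, abs_mul_abs_self, mul_assoc]
    have h2 : (N - ∑ j ∈ Finset.univ.erase i, ν j * (c j + ∑ t, z i j t * u t)) * c i
        ≤ (|N| + (Real.sqrt V * (A / 2) + V * K)) * |c i| := by
      refine (le_abs_self _).trans ?_
      rw [abs_mul]
      refine mul_le_mul_of_nonneg_right ?_ hpos.le
      exact (abs_sub _ _).trans (by linarith)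
    linarith
  have hsV : 0 < Real.sqrt V := Real.sqrt_pos.2 hVpos
  have hdiv : |c i| ≤ |N| / V + A / (2 * Real.sqrt V) + K := by
    have : |c i| ≤ (|N| + (Real.sqrt V * (A / 2) + V * K)) / V := by
      rw [le_div_iff₀ hVpos]; linarith
    refine this.trans_eq ?_
    have key : ∀ s : ℝ, 0 < s →
        (|N| + (s * (A / 2) + s * s * K)) / (s * s) = |N| / (s * s) + A / (2 * s) + K := by
      intro s hs
      field_simp
      ring
    have := key _ hsV
    rwa [Real.mul_self_sqrt hVpos.le] at this
  refine hdiv.trans ?_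
  have h1 : |N| / V ≤ 6 * b * |N| / n := by
    rw [div_le_iff₀ hVpos]
    have : 6 * b * |N| / n * (n / (6 * b)) = |N| := by field_simp
    calc |N| = 6 * b * |N| / n * (n / (6 * b)) := this.symm
      _ ≤ _ := mul_le_mul_of_nonneg_left hVlow (by positivity)
  have h2 : A / (2 * Real.sqrt V) ≤ 2 * Real.sqrt (b / n) * A := by
    rw [div_le_iff₀ (by positivity)]
    have h3 : 1 ≤ 4 * (Real.sqrt (b / n) * Real.sqrt V) := by
      rw [← Real.sqrt_mul (by positivity)]
      have : (1 / 4 : ℝ) ≤ Real.sqrt (b / n * V) := by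
        refine Real.le_sqrt_of_sq_le ?_
        calc ((1 : ℝ) / 4) ^ 2 ≤ b / n * (n / (6 * b)) := by field_simp; norm_num
          _ ≤ _ := mul_le_mul_of_nonneg_left hVlow (by positivity)
      linarith
    have hA0 : 0 ≤ A := Real.sqrt_nonneg _
    calc A ≤ A * (4 * (Real.sqrt (b / n) * Real.sqrt V)) := le_mul_of_one_le_right hA0 h3
      _ = _ := by ring
  linarith

/-- With the `ℓ²`-norm bounded by the information, the influence of all other nodes costs only `b √S
/ n` plus a covariate term. -/
lemma abs_le_of_row_infoForm {b K N : ℝ} (hn : 4 ≤ n) (hb1 : 1 ≤ b)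
    (hb : ∀ i j, i ≠ j → (edgeVar z β γ i j)⁻¹ ≤ b) (i : Fin n) (ν : Fin n → ℝ)
    (hν : ∀ j, j ≠ i → edgeVar z β γ i j / 3 ≤ ν j) (hν' : ∀ j, j ≠ i → ν j ≤ 1 / 4)
    (c : Fin n → ℝ) (u : Fin p → ℝ) (hK : ∀ i j, i ≠ j → |∑ t, z i j t * u t| ≤ K)
    (hrow : (∑ j ∈ Finset.univ.erase i, ν j * linPred z c u i j - N) * c i ≤ 0) :
    |c i| ≤ 6 * b * |N| / n + 4 * b * Real.sqrt (infoForm z β γ c u) / n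
      + 5 * Real.sqrt b * K := by
  have hb0 : 0 < b := by linarith
  have hn0 : (0 : ℝ) < n := by
    have : (4 : ℝ) ≤ n := by exact_mod_cast hn
    linarith
  have hK0 : 0 ≤ K := by
    have : Nontrivial (Fin n) := Fin.nontrivial_iff_two_le.2 (by omega)
    obtain ⟨j, hj⟩ := exists_ne i
    exact (abs_nonneg _).trans (hK j i hj)
  have h1 := abs_le_of_row (by omega) hb0 i ν (fun j hj => by
    refine le_trans ?_ (hν j hj)
    have hv := edgeVar_pos (z := z) β γ i j
    have h := hb i j hj.symm
    rw [inv_eq_one_div, div_le_iff₀ hv] at h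
    rw [div_le_div_iff₀ (by positivity) (by norm_num)]
    linarith) hν' c u (fun j hj => hK i j hj.symm) hrow
  have h2 := sum_sq_le_infoForm hn hb c u hK
  set S := infoForm z β γ c u with hS
  have hS0 : 0 ≤ S := infoForm_nonneg c u
  have h3 : Real.sqrt (∑ j, c j ^ 2)
      ≤ 2 * Real.sqrt (b / n) * Real.sqrt S + 3 / 2 * Real.sqrt n * K := by
    refine Real.sqrt_le_iff.2 ⟨by positivity, h2.trans ?_⟩
    have e1 : Real.sqrt (b / n) ^ 2 = b / n := Real.sq_sqrt (by positivity)
    have e2 : Real.sqrt S ^ 2 = S := Real.sq_sqrt hS0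
    have e3 : Real.sqrt n ^ 2 = n := Real.sq_sqrt hn0.le
    have e4 : (2 * Real.sqrt (b / n) * Real.sqrt S + 3 / 2 * Real.sqrt n * K) ^ 2
        = 4 * (b / n) * S + 9 / 4 * n * K ^ 2
          + 6 * (Real.sqrt (b / n) * Real.sqrt S * Real.sqrt n * K) := by
      linear_combination (4 * Real.sqrt (b / n) ^ 2) * e2 + 4 * S * e1 + 9 / 4 * K ^ 2 * e3
    rw [e4]
    have : 0 ≤ Real.sqrt (b / n) * Real.sqrt S * Real.sqrt n * K := by positivity
    have : 4 * b * S / n = 4 * (b / n) * S := by ring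
    nlinarith [mul_nonneg hn0.le (sq_nonneg K)]
  have h4 : 2 * Real.sqrt (b / n) * Real.sqrt (∑ j, c j ^ 2)
      ≤ 4 * b * Real.sqrt S / n + 3 * Real.sqrt b * K := by
    refine (mul_le_mul_of_nonneg_left h3 (by positivity)).trans_eq ?_
    have e1 : Real.sqrt (b / n) ^ 2 = b / n := Real.sq_sqrt (by positivity)
    have e2 : Real.sqrt (b / n) * Real.sqrt n = Real.sqrt b := by
      rw [← Real.sqrt_mul (by positivity), div_mul_cancel₀ _ hn0.ne']
    linear_combination (4 * Real.sqrt S) * e1 + 3 * K * e2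
  have h5 : K ≤ Real.sqrt b * K :=
    le_mul_of_one_le_left hK0 (Real.one_le_sqrt.2 hb1)
  linarith

/-- A vector representing the `t`-th covariate coordinate with respect to the information form,
whose covariate part has norm at most `R`. -/
structure IsRepresenter (z : Fin n → Fin n → Fin p → ℝ) (β : Fin n → ℝ) (γ : Fin p → ℝ) (R : ℝ)
    (t : Fin p) (α : Fin n → ℝ) (h : Fin p → ℝ) : Prop where
  norm_le : ‖h‖ ≤ R
  row : ∀ i, ∑ j ∈ Finset.univ.erase i, edgeVar z β γ i j * linPred z α h i j = 0
  pairing : ∀ (c : Fin n → ℝ) (u : Fin p → ℝ), ∑ e : Pair n, edgeVar z β γ e.1.1 e.1.2 *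
        linPred z α h e.1.1 e.1.2 * linPred z c u e.1.1 e.1.2 = u t

namespace IsRepresenter
variable {R : ℝ} {t : Fin p} {α : Fin n → ℝ} {h : Fin p → ℝ}

lemma infoForm_eq (hw : IsRepresenter z β γ R t α h) : infoForm z β γ α h = h t := by
  rw [← hw.pairing α h, infoForm]
  exact Finset.sum_congr rfl fun e _ => by ring

/-- Cauchy–Schwarz against the representer, whose own information is `h t ≤ R`. -/
lemma sq_le (hw : IsRepresenter z β γ R t α h) (c : Fin n → ℝ) (u : Fin p → ℝ) :
    u t ^ 2 ≤ R * infoForm z β γ c u := by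
  have h1 := sq_sum_mul_le_infoForm (z := z) (β := β) (γ := γ) α c h u
  rw [hw.pairing, hw.infoForm_eq] at h1
  refine h1.trans (mul_le_mul_of_nonneg_right ?_ (infoForm_nonneg _ _))
  exact (le_abs_self _).trans ((norm_le_pi_norm h t).trans hw.norm_le)

/-- The pairing of `(α, h)` with `(0, h)` is again `h t`, the information of `(α, h)` itself. By
Cauchy–Schwarz the node part `α` can only lower the information, so `(0, h)` bounds it edge by edge.
-/
lemma infoForm_le {K : ℝ} (hw : IsRepresenter z β γ R t α h)
    (hK : ∀ i j, i ≠ j → |∑ t, z i j t * h t| ≤ K) :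
    infoForm z β γ α h ≤ (n * K / 2) ^ 2 := by
  have h1 := sq_sum_mul_le_infoForm (z := z) (β := β) (γ := γ) α 0 h h
  rw [hw.pairing, ← hw.infoForm_eq] at h1
  have h0 := infoForm_nonneg (z := z) (β := β) (γ := γ) α h
  have h2 : infoForm z β γ α h ≤ infoForm z β γ 0 h := by
    rcases h0.eq_or_lt with h | h
    · rw [← h]; exact infoForm_nonneg _ _
    · rw [sq] at h1; exact le_of_mul_le_mul_left h1 h
  refine h2.trans ?_
  have h3 : infoForm z β γ 0 h ≤ ∑ _e : Pair n, 1 / 4 * K ^ 2 := by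
    refine Finset.sum_le_sum fun e _ => ?_
    refine mul_le_mul (sigmoidSlope_le _) ?_ (sq_nonneg _) (by norm_num)
    have := hK _ _ e.2.ne
    simpa [linPred] using sq_le_sq' (abs_le.1 this).1 (abs_le.1 this).2
  refine h3.trans ?_
  simp only [Finset.sum_const, Finset.card_univ, nsmul_eq_mul]
  have h4 := two_mul_card_pair (n := n)
  nlinarith [mul_nonneg (Nat.cast_nonneg (α := ℝ) n) (sq_nonneg K),
    mul_nonneg (Nat.cast_nonneg (α := ℝ) (Fintype.card (Pair n))) (sq_nonneg K)]

/-- The row bound with no noise term: `2 b K` from the information and `5 b K` from the covariates.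
-/
lemma norm_left_le {b K : ℝ} (hn : 4 ≤ n) (hb1 : 1 ≤ b)
    (hb : ∀ i j, i ≠ j → (edgeVar z β γ i j)⁻¹ ≤ b) (hw : IsRepresenter z β γ R t α h)
    (hK0 : 0 ≤ K) (hK : ∀ i j, i ≠ j → |∑ t, z i j t * h t| ≤ K) (i : Fin n) :
    |α i| ≤ 7 * b * K := by
  have hn0 : (0 : ℝ) < n := by
    have : (4 : ℝ) ≤ n := by exact_mod_cast hn
    linarith
  have h1 := abs_le_of_row_infoForm (N := 0) hn hb1 hb i (fun j => edgeVar z β γ i j)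
    (fun j _ => by linarith [edgeVar_pos (z := z) β γ i j]) (fun j _ => sigmoidSlope_le _) α h hK
    (by rw [hw.row i]; simp)
  have h2 : Real.sqrt (infoForm z β γ α h) ≤ n * K / 2 :=
    Real.sqrt_le_iff.2 ⟨by positivity, hw.infoForm_le hK⟩
  have h3 : Real.sqrt b ≤ b := Real.sqrt_le_iff.2 ⟨by linarith, by nlinarith⟩
  have h4 : 4 * b * Real.sqrt (infoForm z β γ α h) / n ≤ 2 * b * K := by
    rw [div_le_iff₀ hn0]
    calc 4 * b * Real.sqrt (infoForm z β γ α h) ≤ 4 * b * (n * K / 2) :=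
          mul_le_mul_of_nonneg_left h2 (by linarith)
      _ = _ := by ring
  have h5 : 5 * Real.sqrt b * K ≤ 5 * b * K := by gcongr
  simp only [abs_zero, mul_zero, zero_div, zero_add] at h1
  linarith

end IsRepresenter

end Bounds

/-! ### Box minimisers of the negative log-likelihood, and uniqueness. -/

section Optimization
variable {n p : ℕ} {z : Fin n → Fin n → Fin p → ℝ}

/-- The negative log-likelihood whose stationary points solve the moment equations. -/
def negLogLik (z : Fin n → Fin n → Fin p → ℝ) (d : Fin n → ℝ) (y : Fin p → ℝ)
    (β : Fin n → ℝ) (γ : Fin p → ℝ) : ℝ :=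
  ∑ e : Pair n, Real.log (1 + Real.exp (linPred z β γ e.1.1 e.1.2))
    - (∑ i, d i * β i + ∑ t, y t * γ t)

lemma continuous_negLogLik (d : Fin n → ℝ) (y : Fin p → ℝ) :
    Continuous fun x : (Fin n → ℝ) × (Fin p → ℝ) => negLogLik z d y x.1 x.2 := by
  unfold negLogLik linPred
  refine Continuous.sub (continuous_finsetSum _ fun e _ => Continuous.log (by fun_prop) ?_)
    (by fun_prop)
  intro x
  positivity

lemma edgeProb_comm (hz : ∀ i j, z i j = z j i) (β : Fin n → ℝ) (γ : Fin p → ℝ) (i j : Fin n) :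
    edgeProb z β γ i j = edgeProb z β γ j i := by
  rw [edgeProb, linPred_comm hz, edgeProb]

/-- The gradient in an arbitrary direction, as a sum over edges. The direction is later the
displacement itself (energy estimate, uniqueness) or a representer (covariate rate). -/
lemma sum_F_add_sum_Q (hz : ∀ i j, z i j = z j i) (d : Fin n → ℝ) (y : Fin p → ℝ)
    (β c : Fin n → ℝ) (γ u : Fin p → ℝ) :
    ∑ i, F z d β γ i * c i + ∑ t, Q z y β γ t * u t
      = ∑ e : Pair n, edgeProb z β γ e.1.1 e.1.2 * linPred z c u e.1.1 e.1.2
        - (∑ i, d i * c i + ∑ t, y t * u t) := by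
  rw [sum_pair_mul_linPred (edgeProb_comm hz β γ) c u]
  simp only [F, Q, meanDegree, meanCov, sub_mul, Finset.sum_sub_distrib]
  rw [Finset.sum_congr rfl fun i _ => mul_comm (∑ j ∈ Finset.univ.erase i, edgeProb z β γ i j) _,
    Finset.sum_congr rfl fun t _ => mul_comm
      (∑ e : Pair n, z e.1.1 e.1.2 t * edgeProb z β γ e.1.1 e.1.2) _]
  ring

lemma hasDerivAt_negLogLik (hz : ∀ i j, z i j = z j i) (d : Fin n → ℝ) (y : Fin p → ℝ)
    (β c : Fin n → ℝ) (γ u : Fin p → ℝ) :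
    HasDerivAt (fun r : ℝ => negLogLik z d y (β + r • c) (γ + r • u))
      (∑ i, F z d β γ i * c i + ∑ t, Q z y β γ t * u t) 0 := by
  rw [sum_F_add_sum_Q hz]
  have hlin : ∀ a m : ℝ, HasDerivAt (fun r : ℝ => a + r * m) m 0 := fun a m => by
    simpa using ((hasDerivAt_id (0 : ℝ)).mul_const m).const_add a
  unfold negLogLik
  refine HasDerivAt.sub (HasDerivAt.fun_sum fun e _ => ?_) (HasDerivAt.add ?_ ?_)
  · simp_rw [linPred_add, linPred_smul]
    have h := HasDerivAt.comp (0 : ℝ) (h := fun r : ℝ => linPred z β γ e.1.1 e.1.2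
      + r * linPred z c u e.1.1 e.1.2) (hasDerivAt_log_one_add_exp _) (hlin _ _)
    simpa [edgeProb] using! h
  · refine HasDerivAt.fun_sum fun i _ => ?_
    simpa [mul_add, mul_left_comm] using hlin (d i * β i) (d i * c i)
  · refine HasDerivAt.fun_sum fun i _ => ?_
    simpa [mul_add, mul_left_comm] using hlin (y i * γ i) (y i * u i)

/-- A minimizer of the negative log-likelihood over a box satisfies the variational inequality. -/
lemma exists_variational_solution (hz : ∀ i j, z i j = z j i) (d : Fin n → ℝ) (y : Fin p → ℝ)
    (β : Fin n → ℝ) (γ : Fin p → ℝ) {r s : ℝ} (hr : 0 ≤ r) (hs : 0 ≤ s) :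
    ∃ β' ∈ Metric.closedBall β r, ∃ γ' ∈ Metric.closedBall γ s,
      ∀ b ∈ Metric.closedBall β r, ∀ g ∈ Metric.closedBall γ s,
        0 ≤ ∑ i, F z d β' γ' i * (b i - β' i) + ∑ t, Q z y β' γ' t * (g t - γ' t) := by
  have hcomp : IsCompact (Metric.closedBall β r ×ˢ Metric.closedBall γ s) :=
    (isCompact_closedBall _ _).prod (isCompact_closedBall _ _)
  obtain ⟨x, hx, hmin⟩ := hcomp.exists_isMinOn
    ⟨(β, γ), Metric.mem_closedBall_self hr, Metric.mem_closedBall_self hs⟩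
    (continuous_negLogLik (z := z) d y).continuousOn
  refine ⟨x.1, hx.1, x.2, hx.2, fun b hb g hg => ?_⟩
  have hd := (hasDerivAt_negLogLik hz d y x.1 (b - x.1) x.2 (g - x.2)).hasDerivWithinAt
    (s := Set.Ioi 0)
  rw [hasDerivWithinAt_iff_tendsto_slope' (by simp)] at hd
  refine ge_of_tendsto hd ?_
  have h1 : Set.Ioo (0 : ℝ) 1 ∈ 𝓝[>] (0 : ℝ) := Ioo_mem_nhdsGT one_pos
  filter_upwards [h1] with ε hε
  rw [slope_def_field]
  refine div_nonneg (sub_nonneg.2 ?_) (by linarith [hε.1])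
  have hb' : x.1 + ε • (b - x.1) ∈ Metric.closedBall β r :=
    (convex_closedBall β r).add_smul_sub_mem hx.1 hb ⟨hε.1.le, hε.2.le⟩
  have hg' : x.2 + ε • (g - x.2) ∈ Metric.closedBall γ s :=
    (convex_closedBall γ s).add_smul_sub_mem hx.2 hg ⟨hε.1.le, hε.2.le⟩
  simpa using hmin (show (x.1 + ε • (b - x.1), x.2 + ε • (g - x.2)) ∈
    Metric.closedBall β r ×ˢ Metric.closedBall γ s from ⟨hb', hg'⟩)

/-- Testing with the centre gives the sign. In the interior, a step against `f` of length equal to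
the remaining room stays admissible and forces `f = 0`. -/
lemma variational_coord {f x₀ x r : ℝ} (hx : |x - x₀| ≤ r)
    (h : ∀ x', |x' - x₀| ≤ r → 0 ≤ f * (x' - x)) :
    f * (x - x₀) ≤ 0 ∧ (|x - x₀| < r → f = 0) := by
  have hr : 0 ≤ r := (abs_nonneg _).trans hx
  refine ⟨by have := h x₀ (by simpa using hr); linarith, fun hlt => ?_⟩
  by_contra hf
  have hpos : 0 < r - |x - x₀| := by linarith
  have hfa : 0 < |f| := abs_pos.2 hf
  have h1 := h (x - (r - |x - x₀|) / |f| * f) (by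
    have e : x - (r - |x - x₀|) / |f| * f - x₀ = (x - x₀) - (r - |x - x₀|) / |f| * f := by ring
    rw [e]
    refine (abs_sub _ _).trans ?_
    rw [abs_mul, abs_div, abs_abs, abs_of_pos hpos, div_mul_cancel₀ _ hfa.ne']
    linarith)
  have h2 : 0 < (r - |x - x₀|) / |f| * (f * f) :=
    mul_pos (div_pos hpos hfa) (mul_self_pos.2 hf)
  linarith

/-- Available by compactness for any data. The sign conditions suffice for the a priori estimates,
which afterwards exclude the boundary. -/
lemma exists_box_solution (hz : ∀ i j, z i j = z j i) (d : Fin n → ℝ) (y : Fin p → ℝ)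
    (β : Fin n → ℝ) (γ : Fin p → ℝ) {r s : ℝ} (hr : 0 ≤ r) (hs : 0 ≤ s) :
    ∃ (β' : Fin n → ℝ) (γ' : Fin p → ℝ), ‖β' - β‖ ≤ r ∧ ‖γ' - γ‖ ≤ s ∧
      (∀ i, F z d β' γ' i * (β' i - β i) ≤ 0 ∧ (|β' i - β i| < r → F z d β' γ' i = 0)) ∧
      (∀ t, Q z y β' γ' t * (γ' t - γ t) ≤ 0 ∧ (|γ' t - γ t| < s → Q z y β' γ' t = 0)) := by
  obtain ⟨β', hβ', γ', hγ', h⟩ := exists_variational_solution hz d y β γ hr hs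
  have key : ∀ {m : ℕ} (x₀ x : Fin m → ℝ) {q : ℝ}, 0 ≤ q → x ∈ Metric.closedBall x₀ q →
      ∀ i (v : ℝ), |v - x₀ i| ≤ q → Function.update x i v ∈ Metric.closedBall x₀ q := by
    intro m x₀ x q hq hx i v hv
    rw [mem_closedBall_iff_norm, pi_norm_le_iff_of_nonneg hq]
    intro j
    rcases eq_or_ne j i with rfl | hj
    · simpa using hv
    · have := (norm_le_pi_norm (x - x₀) j).trans (mem_closedBall_iff_norm.1 hx)
      simpa [hj] using this
  have hsum : ∀ {m : ℕ} (f x : Fin m → ℝ) (i : Fin m) (v : ℝ),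
      ∑ j, f j * (Function.update x i v j - x j) = f i * (v - x i) := by
    intro m f x i v
    rw [Finset.sum_eq_single i]
    · simp
    · intro j _ hj; simp [hj]
    · simp
  refine ⟨β', γ', mem_closedBall_iff_norm.1 hβ', mem_closedBall_iff_norm.1 hγ', fun i => ?_,
    fun t => ?_⟩
  · refine variational_coord ((norm_le_pi_norm (β' - β) i).trans (mem_closedBall_iff_norm.1 hβ'))
      fun v hv => ?_
    have := h _ (key β β' hr hβ' i v hv) _ hγ'
    rw [hsum] at this
    simpa using this
  · refine variational_coord ((norm_le_pi_norm (γ' - γ) t).trans (mem_closedBall_iff_norm.1 hγ'))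
      fun v hv => ?_
    have := h _ hβ' _ (key γ γ' hs hγ' t v hv)
    rw [hsum] at this
    simpa using this

/-- Solutions of the moment equations are unique as soon as the linear predictor determines the
parameters. -/
lemma IsSolution.unique (hz : ∀ i j, z i j = z j i) {d : Fin n → ℝ} {y : Fin p → ℝ}
    {β β' : Fin n → ℝ} {γ γ' : Fin p → ℝ} (h : IsSolution z d y β γ) (h' : IsSolution z d y β' γ')
    (e : Pair n) : linPred z (β' - β) (γ' - γ) e.1.1 e.1.2 = 0 := by
  have h1 := sum_F_add_sum_Q hz d y β (β' - β) γ (γ' - γ)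
  have h2 := sum_F_add_sum_Q hz d y β' (β' - β) γ' (γ' - γ)
  simp only [h.1, h.2, zero_mul, Finset.sum_const_zero, add_zero] at h1
  simp only [h'.1, h'.2, zero_mul, Finset.sum_const_zero, add_zero] at h2
  -- Each summand is nonnegative by monotonicity of the sigmoid, so each vanishes; injectivity then
  -- equates the predictors.
  have h3 : ∑ e : Pair n, (edgeProb z β' γ' e.1.1 e.1.2 - edgeProb z β γ e.1.1 e.1.2)
      * linPred z (β' - β) (γ' - γ) e.1.1 e.1.2 = 0 := by
    simp_rw [sub_mul, Finset.sum_sub_distrib]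
    linarith
  have hnn : ∀ x y : ℝ, 0 ≤ (Real.sigmoid x - Real.sigmoid y) * (x - y) := by
    intro x y
    rcases le_total x y with hxy | hxy
    · exact mul_nonneg_of_nonpos_of_nonpos (by linarith [Real.sigmoid_le hxy]) (by linarith)
    · exact mul_nonneg (by linarith [Real.sigmoid_le hxy]) (by linarith)
  rw [Finset.sum_eq_zero_iff_of_nonneg] at h3
  · have h4 := h3 e (Finset.mem_univ e)
    rcases mul_eq_zero.1 h4 with h5 | h5
    · rw [linPred_sub, sub_eq_zero]
      exact Real.sigmoid_injective (sub_eq_zero.1 h5)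
    · exact h5
  · intro e _
    rw [linPred_sub]
    exact hnn _ _

end Optimization

/-! ### The deterministic argument: localisation and error bounds for small noise. -/

lemma sqrt_mul_div_self {m : ℝ} (hm : 0 < m) (l : ℝ) :
    Real.sqrt (m * l) / m = Real.sqrt (l / m) := by
  have h : l / m = m * l / m ^ 2 := by field_simp
  rw [h, Real.sqrt_div' _ (sq_nonneg m), Real.sqrt_sq hm.le]

section Deterministic
variable {n p : ℕ}

/-- Non-asymptotic conditions on the design, the variance bound `b`, the covariate bound `ζ`, the
inverse information bound `ρ` and the noise level `T`, under which the estimator is localized. -/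
structure Regime (z : Fin n → Fin n → Fin p → ℝ) (β : Fin n → ℝ) (γ : Fin p → ℝ)
    (b ζ ρ T : ℝ) : Prop where
  symm : ∀ i j, z i j = z j i
  four_le : 4 ≤ n
  one_le_log : 1 ≤ Real.log n
  one_le_b : 1 ≤ b
  inv_le : ∀ i j, i ≠ j → (edgeVar z β γ i j)⁻¹ ≤ b
  zStar_le : zStar z ≤ ζ
  one_le_zeta : 1 ≤ ζ
  rho_nonneg : 0 ≤ ρ
  one_le_T : 1 ≤ T
  -- `small_l2` gives `∑ c² ≤ S`, and `small_cov` absorbs the covariate noise. `small_degree` and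
  -- `small_local` push the minimiser off the boundary, and `small_bias` makes the covariate error
  -- harmless for the node rate.
  small_l2 : 4 * b + 2 * p ^ 2 * ζ ^ 2 * ρ ≤ n
  small_cov : ζ ^ 2 * ρ ≤ n
  small_degree : 384 * T * b * Real.sqrt (Real.log n / n) < 1
  small_local : 360 * (p + 1) * T * ζ * Real.sqrt b * Real.sqrt (ρ / n) < 1
  small_bias : ζ ^ 2 * ρ * Real.sqrt b ≤ Real.sqrt (n * Real.log n)

/-- The size conditions on the centred edges `x` and the noise `ξ`, `η` which hold with high
probability. -/
structure GoodNoise (z : Fin n → Fin n → Fin p → ℝ) (β : Fin n → ℝ) (γ : Fin p → ℝ)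
    (ζ ρ T : ℝ) (α : Fin p → Fin n → ℝ) (h : Fin p → Fin p → ℝ)
    (x : Fin n → Fin n → ℝ) (ξ : Fin n → ℝ) (η : Fin p → ℝ) : Prop where
  symm : ∀ i j, x i j = x j i
  -- Uniform in the direction, because the displacement it is applied to depends on the data.
  score : ∀ (c : Fin n → ℝ) (u : Fin p → ℝ), |∑ e : Pair n, x e.1.1 e.1.2 *
    linPred z c u e.1.1 e.1.2| ≤ T * Real.sqrt n * Real.sqrt (infoForm z β γ c u)
  degree_noise : ∑ i, ξ i ^ 2 ≤ T ^ 2 * n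
  cov_noise : ∑ t, |η t| ≤ T * ζ
  representer : ∀ t, |∑ e : Pair n, x e.1.1 e.1.2 * linPred z (α t) (h t) e.1.1 e.1.2|
    ≤ T * (p * ζ * ρ / n)
  degree : ∀ i, |∑ j ∈ Finset.univ.erase i, x i j| ≤ T * Real.sqrt (n * Real.log n)

variable {z : Fin n → Fin n → Fin p → ℝ} {β : Fin n → ℝ} {γ : Fin p → ℝ} {b ζ ρ T : ℝ}

namespace Regime

lemma n_pos (hR : Regime z β γ b ζ ρ T) : (0 : ℝ) < n := by
  have := hR.four_le
  exact_mod_cast (by omega : 0 < n)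

lemma abs_cov_le (hR : Regime z β γ b ζ ρ T) (u : Fin p → ℝ) (i j : Fin n) (hij : i ≠ j) :
    |∑ t, z i j t * u t| ≤ p * ζ * ‖u‖ := by
  refine (abs_sum_mul_le hij u).trans ?_
  have := hR.zStar_le
  gcongr

lemma abs_linPred_le (hR : Regime z β γ b ζ ρ T) (c : Fin n → ℝ) (u : Fin p → ℝ) {A : ℝ}
    (hc : ∀ i, |c i| ≤ A) (i j : Fin n) (hij : i ≠ j) :
    |linPred z c u i j| ≤ 2 * A + p * ζ * ‖u‖ := by
  have h3 := hR.abs_cov_le u i j hij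
  calc |linPred z c u i j| ≤ |c i| + |c j| + |∑ t, z i j t * u t| := abs_add_three _ _ _
    _ ≤ _ := by linarith [hc i, hc j]

end Regime

lemma norm_le_of_representers {R : ℝ} {α : Fin p → Fin n → ℝ} {h : Fin p → Fin p → ℝ}
    (hw : ∀ t, IsRepresenter z β γ R t (α t) (h t)) (c : Fin n → ℝ) (u : Fin p → ℝ) :
    ‖u‖ ≤ Real.sqrt (R * infoForm z β γ c u) :=
  (pi_norm_le_iff_of_nonneg (Real.sqrt_nonneg _)).2 fun t =>
    Real.abs_le_sqrt ((hw t).sq_le c u)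

/-- The total of the released statistics against a direction, in terms of the noise. -/
lemma sum_data (hz : ∀ i j, z i j = z j i) {x : Fin n → Fin n → ℝ} (hx : ∀ i j, x i j = x j i)
    {d ξ : Fin n → ℝ} {y η : Fin p → ℝ}
    (hd : ∀ i, d i = meanDegree z β γ i + ∑ j ∈ Finset.univ.erase i, x i j + ξ i)
    (hy : ∀ t, y t = meanCov z β γ t + ∑ e : Pair n, z e.1.1 e.1.2 t * x e.1.1 e.1.2 + η t)
    (c : Fin n → ℝ) (u : Fin p → ℝ) :
    ∑ i, d i * c i + ∑ t, y t * u t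
      = ∑ e : Pair n, edgeProb z β γ e.1.1 e.1.2 * linPred z c u e.1.1 e.1.2
        + ∑ e : Pair n, x e.1.1 e.1.2 * linPred z c u e.1.1 e.1.2
        + (∑ i, ξ i * c i + ∑ t, η t * u t) := by
  rw [sum_pair_mul_linPred (edgeProb_comm hz β γ) c u, sum_pair_mul_linPred hx c u]
  simp only [hd, hy, meanDegree, meanCov, add_mul, Finset.sum_add_distrib]
  simp only [mul_comm (c _), mul_comm (u _)]
  ring

lemma edgeProb_increment {c : Fin n → ℝ} {u : Fin p → ℝ} {i j : Fin n}
    (hlp : |linPred z c u i j| ≤ 1) :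
    ∃ ν, edgeProb z (β + c) (γ + u) i j - edgeProb z β γ i j = ν * linPred z c u i j ∧
      edgeVar z β γ i j / 3 ≤ ν ∧ ν ≤ 1 / 4 ∧
      |ν - edgeVar z β γ i j| ≤ 2 * edgeVar z β γ i j * |linPred z c u i j| := by
  have := exists_sigmoid_increment (linPred z β γ i j) (linPred z c u i j) hlp
  rwa [← linPred_add] at this

section Localization
variable {α : Fin p → Fin n → ℝ} {h : Fin p → Fin p → ℝ} {x : Fin n → Fin n → ℝ}
  {d ξ c : Fin n → ℝ} {y η u : Fin p → ℝ}

/-- Energy estimate: the equations tested against the displacement give `S / 3` at most the sum of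
three noise terms (score, degree noise, covariate noise), each at most `T √n √S`. -/
lemma sqrt_infoForm_le (hR : Regime z β γ b ζ ρ T)
    (hw : ∀ t, IsRepresenter z β γ (ρ / n ^ 2) t (α t) (h t))
    (hG : GoodNoise z β γ ζ ρ T α h x ξ η)
    (hd : ∀ i, d i = meanDegree z β γ i + ∑ j ∈ Finset.univ.erase i, x i j + ξ i)
    (hy : ∀ t, y t = meanCov z β γ t + ∑ e : Pair n, z e.1.1 e.1.2 t * x e.1.1 e.1.2 + η t)
    (hlp : ∀ e : Pair n, |linPred z c u e.1.1 e.1.2| ≤ 1)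
    (hF : ∀ i, F z d (β + c) (γ + u) i * c i ≤ 0)
    (hQ : ∀ t, Q z y (β + c) (γ + u) t * u t ≤ 0) :
    Real.sqrt (infoForm z β γ c u) ≤ 9 * T * Real.sqrt n := by
  have hn := hR.n_pos
  set S := infoForm z β γ c u with hS
  have hS0 : 0 ≤ S := infoForm_nonneg c u
  have hT : 0 ≤ T := by linarith [hR.one_le_T]
  have hζ : 0 ≤ ζ := by linarith [hR.one_le_zeta]
  have h1 := sum_F_add_sum_Q hR.symm d y (β + c) c (γ + u) u
  rw [sum_data hR.symm hG.symm hd hy] at h1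
  have h2 : ∑ i, F z d (β + c) (γ + u) i * c i + ∑ t, Q z y (β + c) (γ + u) t * u t ≤ 0 :=
    add_nonpos (Finset.sum_nonpos fun i _ => hF i) (Finset.sum_nonpos fun t _ => hQ t)
  have h3 : S / 3 ≤ ∑ e : Pair n, edgeProb z (β + c) (γ + u) e.1.1 e.1.2 *
      linPred z c u e.1.1 e.1.2
      - ∑ e : Pair n, edgeProb z β γ e.1.1 e.1.2 * linPred z c u e.1.1 e.1.2 := by
    rw [hS, infoForm, Finset.sum_div, ← Finset.sum_sub_distrib]
    refine Finset.sum_le_sum fun e _ => ?_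
    obtain ⟨ν, e1, e2, -, -⟩ := edgeProb_increment (β := β) (γ := γ) (hlp e)
    rw [← sub_mul, e1]
    nlinarith [mul_le_mul_of_nonneg_right e2 (sq_nonneg (linPred z c u e.1.1 e.1.2))]
  have h4 := (le_abs_self _).trans (hG.score c u)
  have hu := norm_le_of_representers hw c u
  have hu2 : ‖u‖ ^ 2 ≤ ρ / n ^ 2 * S := by
    have := pow_le_pow_left₀ (norm_nonneg u) hu 2
    rwa [Real.sq_sqrt (mul_nonneg (div_nonneg hR.rho_nonneg (by positivity)) hS0)] at this
  have h5 : ∑ i, c i ^ 2 ≤ S := by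
    refine (sum_sq_le_infoForm hR.four_le hR.inv_le c u (hR.abs_cov_le u)).trans ?_
    have e1 : 2 * n * (p * ζ * ‖u‖) ^ 2 ≤ 2 * n * (p * ζ) ^ 2 * (ρ / n ^ 2 * S) := by
      rw [mul_pow, ← mul_assoc]
      exact mul_le_mul_of_nonneg_left hu2 (by positivity)
    have e2 : 4 * b * S / n + 2 * n * (p * ζ) ^ 2 * (ρ / n ^ 2 * S)
        = (4 * b + 2 * p ^ 2 * ζ ^ 2 * ρ) * S / n := by
      field_simp
    have e3 : (4 * b + 2 * p ^ 2 * ζ ^ 2 * ρ) * S / n ≤ S := by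
      rw [div_le_iff₀ hn, mul_comm S]
      exact mul_le_mul_of_nonneg_right hR.small_l2 hS0
    linarith
  have hsn : 0 < Real.sqrt n := Real.sqrt_pos.2 hn
  have h6 : ∑ i, ξ i * c i ≤ T * Real.sqrt n * Real.sqrt S := by
    refine (Real.sum_mul_le_sqrt_mul_sqrt _ _ _).trans ?_
    refine mul_le_mul ?_ (Real.sqrt_le_sqrt h5) (Real.sqrt_nonneg _) (by positivity)
    refine Real.sqrt_le_iff.2 ⟨by positivity, ?_⟩
    rw [mul_pow, Real.sq_sqrt hn.le]
    exact hG.degree_noise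
  have h7 : ∑ t, η t * u t ≤ T * Real.sqrt n * Real.sqrt S := by
    have e1 : ∑ t, η t * u t ≤ (∑ t, |η t|) * ‖u‖ := by
      rw [Finset.sum_mul]
      refine Finset.sum_le_sum fun t _ => (le_abs_self _).trans ?_
      rw [abs_mul]
      exact mul_le_mul_of_nonneg_left (norm_le_pi_norm u t) (abs_nonneg _)
    have e2 : ζ * ‖u‖ ≤ Real.sqrt n * Real.sqrt S := by
      rw [← Real.sqrt_mul hn.le]
      refine Real.le_sqrt_of_sq_le ?_
      rw [mul_pow]
      calc ζ ^ 2 * ‖u‖ ^ 2 ≤ ζ ^ 2 * (ρ / n ^ 2 * S) :=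
            mul_le_mul_of_nonneg_left hu2 (sq_nonneg _)
        _ = ζ ^ 2 * ρ * (S / n ^ 2) := by ring
        _ ≤ n * (S / n ^ 2) := mul_le_mul_of_nonneg_right hR.small_cov (by positivity)
        _ = S / n := by field_simp
        _ ≤ S := div_le_self hS0 (by
            have : (4 : ℝ) ≤ n := by exact_mod_cast hR.four_le
            linarith)
        _ ≤ n * S := le_mul_of_one_le_left hS0 (by
            have : (4 : ℝ) ≤ n := by exact_mod_cast hR.four_le
            linarith)
    calc ∑ t, η t * u t ≤ (∑ t, |η t|) * ‖u‖ := e1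
      _ ≤ T * ζ * ‖u‖ := mul_le_mul_of_nonneg_right hG.cov_noise (norm_nonneg _)
      _ = T * (ζ * ‖u‖) := by ring
      _ ≤ T * (Real.sqrt n * Real.sqrt S) := mul_le_mul_of_nonneg_left e2 hT
      _ = _ := by ring
  have h8 : S ≤ 9 * T * Real.sqrt n * Real.sqrt S := by linarith
  rcases (Real.sqrt_nonneg S).eq_or_lt with h0 | h0
  · rw [← h0]; positivity
  · refine le_of_mul_le_mul_right ?_ h0
    rwa [Real.mul_self_sqrt hS0]

lemma abs_node_le (hR : Regime z β γ b ζ ρ T) (hG : GoodNoise z β γ ζ ρ T α h x ξ η)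
    (hd : ∀ i, d i = meanDegree z β γ i + ∑ j ∈ Finset.univ.erase i, x i j + ξ i)
    (hlp : ∀ i j, i ≠ j → |linPred z c u i j| ≤ 1)
    (hS : Real.sqrt (infoForm z β γ c u) ≤ 9 * T * Real.sqrt n)
    (i : Fin n) (hF : F z d (β + c) (γ + u) i * c i ≤ 0) :
    |c i| ≤ 48 * T * b * Real.sqrt (Real.log n / n) + 5 * Real.sqrt b * (p * ζ * ‖u‖) := by
  have hn := hR.n_pos
  have hT : 0 ≤ T := by linarith [hR.one_le_T]
  have hb : 0 ≤ b := by linarith [hR.one_le_b]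
  have hL := hR.one_le_log
  -- Secant slopes turn the row of `F` into a linear row; the value at `j = i` is never summed.
  have hex : ∀ j, ∃ ν, i ≠ j →
      (edgeProb z (β + c) (γ + u) i j - edgeProb z β γ i j = ν * linPred z c u i j ∧
      edgeVar z β γ i j / 3 ≤ ν ∧ ν ≤ 1 / 4) := by
    intro j
    by_cases hij : i = j
    · exact ⟨0, fun h => absurd hij h⟩
    · obtain ⟨ν, h1, h2, h3, -⟩ := edgeProb_increment (β := β) (γ := γ) (hlp i j hij)
      exact ⟨ν, fun _ => ⟨h1, h2, h3⟩⟩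
  choose ν hν using hex
  set N := ∑ j ∈ Finset.univ.erase i, x i j + ξ i with hN
  have hFi : F z d (β + c) (γ + u) i
      = ∑ j ∈ Finset.univ.erase i, ν j * linPred z c u i j - N := by
    rw [F, hd, meanDegree, meanDegree, Finset.sum_congr rfl fun j hj =>
      ((hν j (Finset.ne_of_mem_erase hj).symm).1).symm, Finset.sum_sub_distrib]
    ring
  rw [hFi] at hF
  have h1 := abs_le_of_row_infoForm hR.four_le hR.one_le_b hR.inv_le i ν
    (fun j hj => (hν j hj.symm).2.1) (fun j hj => (hν j hj.symm).2.2) c u (hR.abs_cov_le u) hF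
  have hsq : Real.sqrt n ≤ Real.sqrt (n * Real.log n) :=
    Real.sqrt_le_sqrt (le_mul_of_one_le_right hn.le hL)
  have hξ : |ξ i| ≤ T * Real.sqrt n := by
    refine abs_le_of_sq_le_sq ?_ (by positivity)
    rw [mul_pow, Real.sq_sqrt hn.le]
    exact (Finset.single_le_sum (f := fun i => ξ i ^ 2) (fun _ _ => sq_nonneg _)
      (Finset.mem_univ i)).trans hG.degree_noise
  have hNle : |N| ≤ 2 * T * Real.sqrt (n * Real.log n) := by
    refine (abs_add_le _ _).trans ?_
    have := hG.degree i
    have := mul_le_mul_of_nonneg_left hsq hT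
    linarith
  have e1 := sqrt_mul_div_self hn (Real.log n)
  have h2 : 6 * b * |N| / n ≤ 12 * T * b * Real.sqrt (Real.log n / n) := by
    rw [← e1]
    calc 6 * b * |N| / n ≤ 6 * b * (2 * T * Real.sqrt (n * Real.log n)) / n := by gcongr
      _ = _ := by ring
  have h3 : 4 * b * Real.sqrt (infoForm z β γ c u) / n
      ≤ 36 * T * b * Real.sqrt (Real.log n / n) := by
    rw [← e1]
    calc 4 * b * Real.sqrt (infoForm z β γ c u) / n
        ≤ 4 * b * (9 * T * Real.sqrt (n * Real.log n)) / n := by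
          gcongr
          exact hS.trans (by gcongr)
      _ = _ := by ring
  linarith

lemma exists_local_solution (hR : Regime z β γ b ζ ρ T)
    (hw : ∀ t, IsRepresenter z β γ (ρ / n ^ 2) t (α t) (h t))
    (hG : GoodNoise z β γ ζ ρ T α h x ξ η)
    (hd : ∀ i, d i = meanDegree z β γ i + ∑ j ∈ Finset.univ.erase i, x i j + ξ i)
    (hy : ∀ t, y t = meanCov z β γ t + ∑ e : Pair n, z e.1.1 e.1.2 t * x e.1.1 e.1.2 + η t) :
    ∃ (c : Fin n → ℝ) (u : Fin p → ℝ), IsSolution z d y (β + c) (γ + u) ∧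
      ∀ i j, i ≠ j → |linPred z c u i j| ≤ 1 := by
  have hn := hR.n_pos
  have hT := hR.one_le_T
  have hζ := hR.one_le_zeta
  have hp : (0 : ℝ) ≤ p := Nat.cast_nonneg p
  -- The box keeps the predictor within `2 · 1/4 + 1/4 < 1`, the range of the increment lemma; `p +
  -- 1` covers `p = 0`.
  set s : ℝ := 1 / (4 * (p + 1) * ζ) with hs
  have hs0 : 0 < s := by positivity
  obtain ⟨β', γ', hβ, hγ, hF, hQ⟩ := exists_box_solution hR.symm d y β γ
    (by norm_num : (0 : ℝ) ≤ 1 / 4) hs0.le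
  set c := β' - β with hc
  set u := γ' - γ with hu
  have eβ : β' = β + c := by rw [hc]; abel
  have eγ : γ' = γ + u := by rw [hu]; abel
  have hu1 : p * ζ * ‖u‖ ≤ 1 / 4 := by
    calc p * ζ * ‖u‖ ≤ (p + 1) * ζ * s := by gcongr; linarith
      _ = 1 / 4 := by rw [hs]; field_simp
  have hlp : ∀ i j, i ≠ j → |linPred z c u i j| ≤ 1 := by
    intro i j hij
    have := hR.abs_linPred_le c u (fun i => (norm_le_pi_norm c i).trans hβ) i j hij
    linarith
  rw [eβ, eγ] at hF hQ
  have hS := sqrt_infoForm_le hR hw hG hd hy (fun e => hlp _ _ e.2.ne)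
    (fun i => by simpa [hc] using (hF i).1) (fun t => by simpa [hu] using (hQ t).1)
  have hun : ‖u‖ ≤ 9 * T * Real.sqrt (ρ / n) := by
    refine (norm_le_of_representers hw c u).trans ?_
    rw [Real.sqrt_mul (div_nonneg hR.rho_nonneg (by positivity))]
    calc Real.sqrt (ρ / n ^ 2) * Real.sqrt (infoForm z β γ c u)
        ≤ Real.sqrt (ρ / n ^ 2) * (9 * T * Real.sqrt n) :=
          mul_le_mul_of_nonneg_left hS (Real.sqrt_nonneg _)
      _ = 9 * T * (Real.sqrt (ρ / n ^ 2) * Real.sqrt n) := by ring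
      _ = _ := by
        rw [← Real.sqrt_mul (div_nonneg hR.rho_nonneg (by positivity))]
        congr 2
        field_simp
  have hb1 : 1 ≤ Real.sqrt b := Real.one_le_sqrt.2 hR.one_le_b
  have hloc : 40 * (p + 1) * ζ * (Real.sqrt b * ‖u‖) < 1 := by
    refine lt_of_le_of_lt ?_ hR.small_local
    calc 40 * (p + 1) * ζ * (Real.sqrt b * ‖u‖)
        ≤ 40 * (p + 1) * ζ * (Real.sqrt b * (9 * T * Real.sqrt (ρ / n))) := by gcongr
      _ = _ := by ring
  have hu2 : ‖u‖ < s := by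
    rw [hs, lt_div_iff₀ (by positivity)]
    refine lt_of_le_of_lt ?_ hloc
    have h1 : ‖u‖ ≤ Real.sqrt b * ‖u‖ := le_mul_of_one_le_left (norm_nonneg _) hb1
    calc ‖u‖ * (4 * (p + 1) * ζ) = 4 * (p + 1) * ζ * ‖u‖ := by ring
      _ ≤ 40 * (p + 1) * ζ * (Real.sqrt b * ‖u‖) := by gcongr; norm_num
  -- Each half of the node bound is below `1 / 8`: `384 = 8 · 48` in `small_degree`, and `40 = 8 ·
  -- 5` in `hloc`.
  have hc2 : ∀ i, |c i| < 1 / 4 := by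
    intro i
    have h1 := abs_node_le hR hG hd hlp hS i (by simpa [hc] using (hF i).1)
    have h2 := hR.small_degree
    have h3 : 5 * Real.sqrt b * (p * ζ * ‖u‖) ≤ 5 * ((p + 1) * ζ * (Real.sqrt b * ‖u‖)) := by
      calc 5 * Real.sqrt b * (p * ζ * ‖u‖) = 5 * (p * ζ * (Real.sqrt b * ‖u‖)) := by ring
        _ ≤ _ := by gcongr; linarith
    linarith
  refine ⟨c, u, ⟨fun i => (hF i).2 (by simpa [hc] using hc2 i), fun t => (hQ t).2 ?_⟩, hlp⟩
  have := (norm_le_pi_norm u t).trans_lt hu2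
  simpa [hu] using this

set_option maxHeartbeats 1000000 in
-- Testing with the representer `w = (α t, h t)` isolates `u t`. The linearisation error is relative
-- to the slope, hence at most `2 S max |w|`, with `S ≤ 81 T² n` and `max |w| ≤ (2 · 7 + 1) b K`.
-- This remainder produces the main constant `2430 = 2 · 81 · 15`.
lemma abs_cov_coord_le (hR : Regime z β γ b ζ ρ T)
    (hw : ∀ t, IsRepresenter z β γ (ρ / n ^ 2) t (α t) (h t))
    (hG : GoodNoise z β γ ζ ρ T α h x ξ η)
    (hd : ∀ i, d i = meanDegree z β γ i + ∑ j ∈ Finset.univ.erase i, x i j + ξ i)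
    (hy : ∀ t, y t = meanCov z β γ t + ∑ e : Pair n, z e.1.1 e.1.2 t * x e.1.1 e.1.2 + η t)
    (hsol : IsSolution z d y (β + c) (γ + u)) (hlp : ∀ i j, i ≠ j → |linPred z c u i j| ≤ 1)
    (hS : Real.sqrt (infoForm z β γ c u) ≤ 9 * T * Real.sqrt n) (t : Fin p) :
    |u t| ≤ 2500 * (p + 1) * T ^ 2 * (b * ζ * ρ / n) := by
  have hn := hR.n_pos
  have hT := hR.one_le_T
  have hζ := hR.one_le_zeta
  have hb := hR.one_le_b
  have hρ := hR.rho_nonneg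
  have hp : (0 : ℝ) ≤ p := Nat.cast_nonneg p
  set K : ℝ := p * ζ * (ρ / n ^ 2) with hKdef
  have hK0 : 0 ≤ K := by positivity
  have hKh : ∀ i j, i ≠ j → |∑ s, z i j s * h t s| ≤ K := fun i j hij =>
    (hR.abs_cov_le (h t) i j hij).trans
      (mul_le_mul_of_nonneg_left (hw t).norm_le (by positivity))
  have hα := (hw t).norm_left_le hR.four_le hb hR.inv_le hK0 hKh
  have hlw : ∀ e : Pair n, |linPred z (α t) (h t) e.1.1 e.1.2| ≤ 15 * b * K := by
    intro e
    have h1 := hR.abs_linPred_le (α t) (h t) hα _ _ e.2.ne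
    have h2 : p * ζ * ‖h t‖ ≤ K := mul_le_mul_of_nonneg_left (hw t).norm_le (by positivity)
    nlinarith
  have h1 := sum_F_add_sum_Q hR.symm d y (β + c) (α t) (γ + u) (h t)
  simp only [hsol.1, hsol.2, zero_mul, Finset.sum_const_zero, add_zero] at h1
  rw [sum_data hR.symm hG.symm hd hy] at h1
  set S := infoForm z β γ c u with hSdef
  have hS0 : 0 ≤ S := infoForm_nonneg c u
  have hSn : S ≤ 81 * T ^ 2 * n := by
    have := pow_le_pow_left₀ (Real.sqrt_nonneg _) hS 2
    rw [Real.sq_sqrt hS0, mul_pow, Real.sq_sqrt hn.le] at this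
    linarith
  have h2 : |∑ e : Pair n, (edgeProb z (β + c) (γ + u) e.1.1 e.1.2 - edgeProb z β γ e.1.1 e.1.2)
      * linPred z (α t) (h t) e.1.1 e.1.2 - u t| ≤ 2 * S * (15 * b * K) := by
    rw [← (hw t).pairing c u, ← Finset.sum_sub_distrib]
    refine (Finset.abs_sum_le_sum_abs _ _).trans ?_
    rw [hSdef, infoForm, Finset.mul_sum, Finset.sum_mul]
    refine Finset.sum_le_sum fun e _ => ?_
    obtain ⟨ν, e1, -, -, e4⟩ := edgeProb_increment (β := β) (γ := γ) (hlp _ _ e.2.ne)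
    rw [e1]
    have e5 : ν * linPred z c u e.1.1 e.1.2 * linPred z (α t) (h t) e.1.1 e.1.2
        - edgeVar z β γ e.1.1 e.1.2 * linPred z (α t) (h t) e.1.1 e.1.2
          * linPred z c u e.1.1 e.1.2
        = (ν - edgeVar z β γ e.1.1 e.1.2) * linPred z c u e.1.1 e.1.2
          * linPred z (α t) (h t) e.1.1 e.1.2 := by ring
    rw [e5, abs_mul, abs_mul]
    have hv := (edgeVar_pos (z := z) β γ e.1.1 e.1.2).le
    refine mul_le_mul ?_ (hlw e) (abs_nonneg _) (by positivity)
    calc |ν - edgeVar z β γ e.1.1 e.1.2| * |linPred z c u e.1.1 e.1.2|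
        ≤ 2 * edgeVar z β γ e.1.1 e.1.2 * |linPred z c u e.1.1 e.1.2|
          * |linPred z c u e.1.1 e.1.2| := mul_le_mul_of_nonneg_right e4 (abs_nonneg _)
      _ = _ := by rw [← sq_abs (linPred z c u e.1.1 e.1.2)]; ring
  have h3 : ∑ e : Pair n, (edgeProb z (β + c) (γ + u) e.1.1 e.1.2 - edgeProb z β γ e.1.1 e.1.2)
      * linPred z (α t) (h t) e.1.1 e.1.2
      = ∑ e : Pair n, x e.1.1 e.1.2 * linPred z (α t) (h t) e.1.1 e.1.2
        + (∑ i, ξ i * α t i + ∑ s, η s * h t s) := by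
    simp_rw [sub_mul, Finset.sum_sub_distrib]
    linarith
  rw [h3] at h2
  have h4 := hG.representer t
  have h5 : |∑ i, ξ i * α t i| ≤ T * n * (7 * b * K) := by
    have e1 : ∑ i, |ξ i| ≤ T * n := by
      have e2 := Finset.sum_mul_sq_le_sq_mul_sq Finset.univ (fun i => |ξ i|) fun _ => (1 : ℝ)
      simp only [mul_one, sq_abs, one_pow, Finset.sum_const, Finset.card_univ, Fintype.card_fin,
        nsmul_eq_mul] at e2
      refine abs_le_of_sq_le_sq' ?_ (by positivity) |>.2
      refine e2.trans ?_
      calc (∑ i, ξ i ^ 2) * n ≤ T ^ 2 * n * n :=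
            mul_le_mul_of_nonneg_right hG.degree_noise hn.le
        _ = _ := by ring
    refine (Finset.abs_sum_le_sum_abs _ _).trans ?_
    calc ∑ i, |ξ i * α t i| ≤ ∑ i, |ξ i| * (7 * b * K) := by
          refine Finset.sum_le_sum fun i _ => ?_
          rw [abs_mul]
          exact mul_le_mul_of_nonneg_left (hα i) (abs_nonneg _)
      _ ≤ _ := by
          rw [← Finset.sum_mul]
          exact mul_le_mul_of_nonneg_right e1 (by positivity)
  have h6 : |∑ s, η s * h t s| ≤ T * ζ * (ρ / n ^ 2) := by
    refine (Finset.abs_sum_le_sum_abs _ _).trans ?_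
    calc ∑ s, |η s * h t s| ≤ ∑ s, |η s| * (ρ / n ^ 2) := by
          refine Finset.sum_le_sum fun s _ => ?_
          rw [abs_mul]
          exact mul_le_mul_of_nonneg_left ((norm_le_pi_norm (h t) s).trans (hw t).norm_le)
            (abs_nonneg _)
      _ ≤ _ := by
          rw [← Finset.sum_mul]
          exact mul_le_mul_of_nonneg_right hG.cov_noise (by positivity)
  set B : ℝ := b * ζ * ρ / n with hB
  have hB0 : 0 ≤ B := by positivity
  have hnK : n * (b * K) = p * B := by rw [hKdef, hB]; field_simp
  have b1 : 2 * S * (15 * b * K) ≤ 2430 * T ^ 2 * (p * B) := by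
    rw [← hnK]
    calc 2 * S * (15 * b * K) ≤ 2 * (81 * T ^ 2 * n) * (15 * b * K) := by gcongr
      _ = _ := by ring
  have b2 : T * (p * ζ * ρ / n) ≤ T ^ 2 * (p * B) := by
    have : p * ζ * ρ / n ≤ p * B := by
      rw [hB]
      calc p * ζ * ρ / n = p * (1 * ζ * ρ / n) := by ring
        _ ≤ _ := by gcongr
    calc T * (p * ζ * ρ / n) ≤ T * (p * B) := by gcongr
      _ ≤ _ := by gcongr; nlinarith
  have b3 : T * n * (7 * b * K) ≤ 7 * T ^ 2 * (p * B) := by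
    rw [← hnK]
    calc T * n * (7 * b * K) = 7 * T * (n * (b * K)) := by ring
      _ ≤ _ := by gcongr; nlinarith
  have b4 : T * ζ * (ρ / n ^ 2) ≤ T ^ 2 * B := by
    have h4n : (1 : ℝ) ≤ n := by
      have : (4 : ℝ) ≤ n := by exact_mod_cast hR.four_le
      linarith
    have e1 : ζ * (ρ / n ^ 2) ≤ B := by
      rw [hB]
      calc ζ * (ρ / n ^ 2) = 1 * ζ * ρ / (n * n) := by ring
        _ ≤ b * ζ * ρ / (1 * n) := by gcongr
        _ = _ := by ring
    calc T * ζ * (ρ / n ^ 2) = T * (ζ * (ρ / n ^ 2)) := by ring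
      _ ≤ T * B := by gcongr
      _ ≤ _ := by gcongr; nlinarith
  have hfin : |u t| ≤ 2430 * T ^ 2 * (p * B) + T ^ 2 * (p * B) + 7 * T ^ 2 * (p * B) + T ^ 2 * B := by
    rw [abs_le] at h2 h4 h5 h6 ⊢
    constructor <;> linarith
  have : 0 ≤ T ^ 2 * B := by positivity
  have : 0 ≤ T ^ 2 * (p * B) := by positivity
  nlinarith

/-- On the event of small noise, a solution of the moment equations exists, and every solution
satisfies the error bounds. -/
theorem solution_bounds (hR : Regime z β γ b ζ ρ T)
    (hw : ∀ t, IsRepresenter z β γ (ρ / n ^ 2) t (α t) (h t))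
    (hG : GoodNoise z β γ ζ ρ T α h x ξ η)
    (hd : ∀ i, d i = meanDegree z β γ i + ∑ j ∈ Finset.univ.erase i, x i j + ξ i)
    (hy : ∀ t, y t = meanCov z β γ t + ∑ e : Pair n, z e.1.1 e.1.2 t * x e.1.1 e.1.2 + η t) :
    (∃ β' γ', IsSolution z d y β' γ') ∧ ∀ β' γ', IsSolution z d y β' γ' →
      ‖γ' - γ‖ ≤ 2500 * (p + 1) * T ^ 2 * (b * ζ * ρ / n) ∧
      ‖β' - β‖ ≤ 12600 * (p + 1) ^ 2 * T ^ 2 * (b * Real.sqrt (Real.log n / n)) := by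
  have hn := hR.n_pos
  have hT := hR.one_le_T
  have hζ := hR.one_le_zeta
  have hb := hR.one_le_b
  have hρ := hR.rho_nonneg
  have hL := hR.one_le_log
  have hp : (0 : ℝ) ≤ p := Nat.cast_nonneg p
  obtain ⟨c, u, hsol, hlp⟩ := exists_local_solution hR hw hG hd hy
  refine ⟨⟨_, _, hsol⟩, fun β' γ' h' => ?_⟩
  have hzero := hsol.unique hR.symm h'
  -- Equal predictors mean zero information, and the representers and the `ℓ²` bound then identify
  -- the parameters.
  have hI : infoForm z β γ (β' - (β + c)) (γ' - (γ + u)) = 0 :=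
    Finset.sum_eq_zero fun e _ => by rw [hzero e]; ring
  have hu' : ‖γ' - (γ + u)‖ = 0 := le_antisymm
    (by simpa [hI] using norm_le_of_representers hw (β' - (β + c)) (γ' - (γ + u))) (norm_nonneg _)
  have hc' : ∑ i, (β' - (β + c)) i ^ 2 ≤ 0 := by
    have := sum_sq_le_infoForm hR.four_le hR.inv_le (β' - (β + c)) _
      (hR.abs_cov_le (γ' - (γ + u)))
    simpa [hI, hu'] using this
  have eγ : γ' - γ = u := by
    have := norm_eq_zero.1 hu'
    rw [sub_eq_zero] at this
    rw [this]; abel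
  have eβ : β' - β = c := by
    ext i
    have h0 := (Finset.single_le_sum (f := fun i => (β' - (β + c)) i ^ 2)
      (fun _ _ => sq_nonneg _) (Finset.mem_univ i)).trans hc'
    have h1 : (β' - (β + c)) i = 0 := pow_eq_zero_iff two_ne_zero |>.1 (le_antisymm h0 (sq_nonneg _))
    simp only [Pi.sub_apply, Pi.add_apply] at h1 ⊢
    linarith
  rw [eγ, eβ]
  have hS := sqrt_infoForm_le hR hw hG hd hy (fun e => hlp _ _ e.2.ne)
    (fun i => by rw [hsol.1 i, zero_mul]) (fun t => by rw [hsol.2 t, zero_mul])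
  have hu : ‖u‖ ≤ 2500 * (p + 1) * T ^ 2 * (b * ζ * ρ / n) :=
    (pi_norm_le_iff_of_nonneg (by positivity)).2
      fun t => abs_cov_coord_le hR hw hG hd hy hsol hlp hS t
  refine ⟨hu, (pi_norm_le_iff_of_nonneg (by positivity)).2 fun i => ?_⟩
  have h1 := abs_node_le hR hG hd hlp hS i (by rw [hsol.1 i, zero_mul])
  set D : ℝ := b * Real.sqrt (Real.log n / n) with hD
  have hD0 : 0 ≤ D := by positivity
  -- By `small_bias`, the refined covariate error contributes no more than the node rate.
  have h2 : Real.sqrt b * (ζ * (b * ζ * ρ / n)) ≤ D := by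
    rw [hD, ← sqrt_mul_div_self hn]
    calc Real.sqrt b * (ζ * (b * ζ * ρ / n)) = b * (ζ ^ 2 * ρ * Real.sqrt b / n) := by ring
      _ ≤ _ := by
        have := hR.small_bias
        gcongr
  have h3 : 5 * Real.sqrt b * (p * ζ * ‖u‖) ≤ 12500 * (p + 1) ^ 2 * T ^ 2 * D := by
    calc 5 * Real.sqrt b * (p * ζ * ‖u‖)
        ≤ 5 * Real.sqrt b * ((p + 1) * ζ * (2500 * (p + 1) * T ^ 2 * (b * ζ * ρ / n))) := by
          gcongr; linarith
      _ = 12500 * (p + 1) ^ 2 * T ^ 2 * (Real.sqrt b * (ζ * (b * ζ * ρ / n))) := by ring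
      _ ≤ _ := by gcongr
  have h4 : 48 * T * b * Real.sqrt (Real.log n / n) ≤ 100 * (p + 1) ^ 2 * T ^ 2 * D := by
    calc 48 * T * b * Real.sqrt (Real.log n / n) = (48 * T) * D := by rw [hD]; ring
      _ ≤ _ := by
        refine mul_le_mul_of_nonneg_right ?_ hD0
        have h5 : 1 ≤ ((p : ℝ) + 1) ^ 2 := one_le_pow₀ (by linarith)
        have h6 : T ≤ T ^ 2 := by nlinarith
        calc 48 * T ≤ 100 * 1 * T ^ 2 := by nlinarith
          _ ≤ _ := by gcongr
  rw [Real.norm_eq_abs]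
  linarith

end Localization

end Deterministic

/-! ### Moment inequalities and moments of the noise laws. -/

section Markov
variable {Ω : Type*} [MeasurableSpace Ω] {P : Measure Ω}

/-- Markov's inequality relative to a bound `q` of the mean, which may vanish. -/
lemma measure_mul_lt_le {Z : Ω → ℝ} (hZ : AEMeasurable Z P) {q T : ℝ} (hq : 0 ≤ q) (hT : 0 < T)
    (h : ∫⁻ ω, ENNReal.ofReal (Z ω) ∂P ≤ ENNReal.ofReal q) :
    P {ω | T * q < Z ω} ≤ ENNReal.ofReal (1 / T) := by
  rcases hq.eq_or_lt with rfl | hq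
  · rw [ENNReal.ofReal_zero, nonpos_iff_eq_zero, lintegral_eq_zero_iff' hZ.ennreal_ofReal] at h
    have h0 : P {ω | T * 0 < Z ω} = 0 := by
      refine measure_mono_null (fun ω hω => ?_) h
      have hω' : 0 < Z ω := by simpa using hω
      simpa using hω'
    rw [h0]; exact zero_le
  · have hTq : 0 < T * q := mul_pos hT hq
    have hε : ENNReal.ofReal (T * q) ≠ 0 := by simpa using hTq
    calc P {ω | T * q < Z ω}
        ≤ P {ω | ENNReal.ofReal (T * q) ≤ ENNReal.ofReal (Z ω)} :=
          measure_mono fun ω hω => ENNReal.ofReal_le_ofReal (le_of_lt hω)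
      _ ≤ (∫⁻ ω, ENNReal.ofReal (Z ω) ∂P) / ENNReal.ofReal (T * q) :=
          meas_ge_le_lintegral_div hZ.ennreal_ofReal hε ENNReal.ofReal_ne_top
      _ ≤ ENNReal.ofReal q / ENNReal.ofReal (T * q) := by gcongr
      _ = ENNReal.ofReal (1 / T) := by
          rw [← ENNReal.ofReal_div_of_pos hTq]
          congr 1
          field_simp

end Markov

section Uncorrelated
variable {Ω ι : Type*} [MeasurableSpace Ω] {P : Measure Ω} [IsProbabilityMeasure P] [Fintype ι]
  {X : ι → Ω → ℝ} {v : ι → ℝ}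

lemma integral_sq_sum_mul (hX : ∀ e, MemLp (X e) 2 P) (hind : iIndepFun X P)
    (hmean : ∀ e, ∫ ω, X e ω ∂P = 0) (hvar : ∀ e, ∫ ω, X e ω ^ 2 ∂P = v e) (w : ι → ℝ) :
    ∫ ω, (∑ e, w e * X e ω) ^ 2 ∂P = ∑ e, w e ^ 2 * v e := by
  have hint : ∀ e, Integrable (fun ω => w e * X e ω) P := fun e =>
    ((hX e).integrable one_le_two).const_mul _
  have h1 : ∀ e, Var[fun ω => w e * X e ω; P] = w e ^ 2 * v e := by
    intro e
    rw [variance_const_mul, variance_of_integral_eq_zero (hX e).aemeasurable (hmean e), hvar]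
  have h2 := IndepFun.variance_sum (s := Finset.univ) (X := fun e ω => w e * X e ω) (μ := P)
    (fun e _ => (hX e).const_mul _) (fun e _ f _ hef =>
      (hind.indepFun hef).comp (measurable_const_mul (w e)) (measurable_const_mul (w f)))
  have h3 : (∑ e, fun ω => w e * X e ω) = fun ω => ∑ e, w e * X e ω := by
    ext ω; simp
  rw [h3, variance_of_integral_eq_zero] at h2
  · rw [h2]; exact Finset.sum_congr rfl fun e _ => h1 e
  · exact (integrable_finsetSum _ fun e _ => hint e).aemeasurable
  · rw [integral_finsetSum _ fun e _ => hint e]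
    exact Finset.sum_eq_zero fun e _ => by rw [integral_const_mul, hmean, mul_zero]

/-- Linear statistics of uncorrelated variables with coefficients in a subspace are bounded,
uniformly over the subspace, by a variable whose mean is the dimension. -/
lemma exists_uniform_bound (hX : ∀ e, MemLp (X e) 2 P) (hind : iIndepFun X P)
    (hmean : ∀ e, ∫ ω, X e ω ∂P = 0) (hvar : ∀ e, ∫ ω, X e ω ^ 2 ∂P = v e) (hv : ∀ e, 0 < v e)
    (U : Submodule ℝ (EuclideanSpace ℝ ι)) :
    ∃ Z : Ω → ℝ, (∀ ω, 0 ≤ Z ω) ∧ Integrable Z P ∧ ∫ ω, Z ω ∂P = Module.finrank ℝ U ∧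
      ∀ ω, ∀ w ∈ U, (∑ e, w e * (X e ω / Real.sqrt (v e))) ^ 2 ≤ Z ω * ‖w‖ ^ 2 := by
  set B := stdOrthonormalBasis ℝ U with hB
  -- Coordinates of the standardised noise in an orthonormal basis of `U`: each has second moment 1,
  -- so `∑ Y²` has mean `dim U` and serves every `w` at once.
  set Y : Fin (Module.finrank ℝ U) → Ω → ℝ := fun k ω =>
    ∑ e, ((B k : EuclideanSpace ℝ ι) e / Real.sqrt (v e)) * X e ω with hY
  have hYm : ∀ k, MemLp (Y k) 2 P := fun k =>
    memLp_finsetSum _ fun e _ => (hX e).const_mul _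
  refine ⟨fun ω => ∑ k, Y k ω ^ 2, fun ω => Finset.sum_nonneg fun _ _ => sq_nonneg _,
    integrable_finsetSum _ fun k _ => (hYm k).integrable_sq, ?_, fun ω w hw => ?_⟩
  · rw [integral_finsetSum _ fun k _ => (hYm k).integrable_sq]
    have : ∀ k, ∫ ω, Y k ω ^ 2 ∂P = 1 := by
      intro k
      rw [hY, integral_sq_sum_mul hX hind hmean hvar]
      have h1 : ‖(B k : EuclideanSpace ℝ ι)‖ ^ 2 = 1 := by
        have := B.orthonormal.1 k
        rw [Submodule.coe_norm] at this
        rw [this, one_pow]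
      rw [← h1, EuclideanSpace.norm_sq_eq]
      refine Finset.sum_congr rfl fun e _ => ?_
      rw [div_pow, Real.sq_sqrt (hv e).le, div_mul_cancel₀ _ (hv e).ne', Real.norm_eq_abs, sq_abs]
    simp [this]
  · set w' : U := ⟨w, hw⟩ with hw'
    have h1 : w = ∑ k, B.repr w' k • (B k : EuclideanSpace ℝ ι) := by
      have := congrArg (Subtype.val) (B.sum_repr w')
      simpa using this.symm
    have h2 : ∑ e, w e * (X e ω / Real.sqrt (v e)) = ∑ k, B.repr w' k * Y k ω := by
      have h3 : ∀ e, w e = ∑ k, B.repr w' k * (B k : EuclideanSpace ℝ ι) e := by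
        intro e
        conv_lhs => rw [h1]
        simp
      simp_rw [hY, Finset.mul_sum, h3, Finset.sum_mul]
      rw [Finset.sum_comm]
      refine Finset.sum_congr rfl fun k _ => Finset.sum_congr rfl fun e _ => ?_
      ring
    have h4 : ‖w‖ ^ 2 = ∑ k, B.repr w' k ^ 2 := by
      have : ‖w'‖ = ‖B.repr w'‖ := (B.repr.norm_map w').symm
      have e : ‖w‖ = ‖w'‖ := rfl
      rw [e, this, EuclideanSpace.norm_sq_eq]
      exact Finset.sum_congr rfl fun k _ => by rw [Real.norm_eq_abs, sq_abs]
    rw [h2, h4, mul_comm]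
    exact Finset.sum_mul_sq_le_sq_mul_sq _ _ _

end Uncorrelated

section NoiseMoments

/-- Since `x² ≤ 4^|x|`, the terms are dominated by a geometric series of ratio `4 / 8`. The
condition on `l` holds eventually because `k / ε → 0`. -/
lemma exists_discreteLaplace_sq_le : ∃ C : ℝ, 0 ≤ C ∧ ∀ l : ℝ, 0 ≤ l → l ≤ 1 / 8 →
    ∫⁻ x, ENNReal.ofReal (x ^ 2) ∂(discreteLaplace l) ≤ ENNReal.ofReal C := by
  have hsum : Summable fun x : ℤ => ((1 : ℝ) / 2) ^ x.natAbs := by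
    refine Summable.of_nat_of_neg ?_ ?_ <;>
      simpa using summable_geometric_of_lt_one (by norm_num : (0 : ℝ) ≤ 1 / 2) (by norm_num)
  refine ⟨∑' x : ℤ, ((1 : ℝ) / 2) ^ x.natAbs, tsum_nonneg fun _ => by positivity,
    fun l hl0 hl => ?_⟩
  rw [discreteLaplace, lintegral_sum_measure, ENNReal.ofReal_tsum_of_nonneg
    (fun _ => by positivity) hsum]
  refine ENNReal.tsum_le_tsum fun x => ?_
  rw [lintegral_smul_measure, lintegral_dirac, smul_eq_mul, ← ENNReal.ofReal_mul]
  · refine ENNReal.ofReal_le_ofReal ?_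
    have h1 : ((x : ℝ)) ^ 2 ≤ 4 ^ x.natAbs := by
      have h2 : (x : ℝ) ^ 2 = (x.natAbs : ℝ) ^ 2 := by
        rw [Nat.cast_natAbs, Int.cast_abs, sq_abs]
      have h3 : (x.natAbs : ℝ) ≤ 2 ^ x.natAbs := by exact_mod_cast (Nat.lt_two_pow_self).le
      calc (x : ℝ) ^ 2 = (x.natAbs : ℝ) ^ 2 := h2
        _ ≤ (2 ^ x.natAbs) ^ 2 := by gcongr
        _ = 4 ^ x.natAbs := by rw [← pow_mul, mul_comm, pow_mul]; norm_num
    have h4 : (1 - l) / (1 + l) ≤ 1 := by rw [div_le_one (by linarith)]; linarith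
    calc (1 - l) / (1 + l) * l ^ x.natAbs * (x : ℝ) ^ 2
        ≤ 1 * (1 / 8) ^ x.natAbs * 4 ^ x.natAbs := by gcongr
      _ = (1 / 2) ^ x.natAbs := by rw [one_mul, ← mul_pow]; norm_num
  · have : 0 ≤ (1 - l) / (1 + l) := div_nonneg (by linarith) (by linarith)
    positivity

lemma lintegral_abs_laplace {l : ℝ} (hl : 0 ≤ l) :
    ∫⁻ x, ENNReal.ofReal |x| ∂(laplace l) = ENNReal.ofReal l := by
  rcases hl.eq_or_lt with rfl | hl
  · simp [laplace]
  · rw [laplace, if_neg hl.ne', lintegral_withDensity_eq_lintegral_mul _ (by fun_prop) (by fun_prop)]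
    have h1 : ∫ x in Set.Ioi (0 : ℝ), Real.exp (-x / l) / (2 * l) * x = l / 2 := by
      have h2 := Real.integral_rpow_mul_exp_neg_mul_Ioi (a := 2) (r := 1 / l) two_pos
        (by positivity)
      have h3 : ∀ x : ℝ, Real.exp (-x / l) / (2 * l) * x
          = 1 / (2 * l) * (x ^ ((2 : ℝ) - 1) * Real.exp (-(1 / l * x))) := by
        intro x
        have e1 : (2 : ℝ) - 1 = 1 := by norm_num
        have e2 : -x / l = -(1 / l * x) := by ring
        rw [e1, Real.rpow_one, e2]
        ring
      simp_rw [h3]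
      rw [integral_const_mul, h2, Real.Gamma_two]
      norm_num
      field_simp
    have h4 : ∫ x, Real.exp (-|x| / l) / (2 * l) * |x| = l := by
      rw [integral_comp_abs (f := fun x => Real.exp (-x / l) / (2 * l) * x), h1]
      ring
    -- A non-integrable function would have integral 0 by convention, and `l ≠ 0`.
    have h5 : Integrable fun x : ℝ => Real.exp (-|x| / l) / (2 * l) * |x| :=
      Integrable.of_integral_ne_zero (by rw [h4]; exact hl.ne')
    calc ∫⁻ x, ((fun x => ENNReal.ofReal (Real.exp (-|x| / l) / (2 * l))) *
          fun x => ENNReal.ofReal |x|) x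
        = ∫⁻ x, ENNReal.ofReal (Real.exp (-|x| / l) / (2 * l) * |x|) := by
          refine lintegral_congr fun x => ?_
          rw [Pi.mul_apply, ← ENNReal.ofReal_mul (by positivity)]
      _ = ENNReal.ofReal l := by
          rw [← ofReal_integral_eq_lintegral_ofReal h5
            (Eventually.of_forall fun x => by positivity), h4]

end NoiseMoments

/-! ### Probability of the good-noise event in the network model. -/

namespace IsNoisyNetwork

/-- The centred edge indicators. -/
def centred {Ω : Type*} {n p : ℕ} (z : Fin n → Fin n → Fin p → ℝ) (β : Fin n → ℝ) (γ : Fin p → ℝ)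
    (a : Ω → Fin n → Fin n → ℝ) (e : Pair n) (ω : Ω) : ℝ :=
  a ω e.1.1 e.1.2 - edgeProb z β γ e.1.1 e.1.2

/-- Independence is indexed by unordered pairs, so the row sum is rewritten over the pairs
containing `i`. -/
lemma sum_centred_node {Ω : Type*} {n p : ℕ} {z : Fin n → Fin n → Fin p → ℝ}
    {β : Fin n → ℝ} {γ : Fin p → ℝ} {a : Ω → Fin n → Fin n → ℝ} (hz : ∀ i j, z i j = z j i)
    (ha : ∀ ω i j, a ω i j = a ω j i) (i : Fin n) (ω : Ω) :
    ∑ j ∈ Finset.univ.erase i, (a ω i j - edgeProb z β γ i j)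
      = ∑ e ∈ Finset.univ.filter (fun e : Pair n => e.1.1 = i ∨ e.1.2 = i),
        centred z β γ a e ω := by
  have h := sum_mul_sum_erase (Pi.single i 1) (fun i j => a ω i j - edgeProb z β γ i j)
    (fun i j => by rw [ha, edgeProb_comm hz])
  simp only [Pi.single_apply, ite_mul, one_mul, zero_mul, Finset.sum_ite_eq', Finset.mem_univ,
    if_true] at h
  rw [h, Finset.sum_filter]
  refine Finset.sum_congr rfl fun e _ => ?_
  have hne := e.2.ne
  by_cases h1 : e.1.1 = i
  · have h2 : e.1.2 ≠ i := fun h2 => hne (h1.trans h2.symm)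
    simp [h1, h2, centred]
  · by_cases h2 : e.1.2 = i <;> simp [h1, h2, centred]

variable {Ω : Type*} [MeasurableSpace Ω] {P : Measure Ω} {n p : ℕ}
  {z : Fin n → Fin n → Fin p → ℝ} {β : Fin n → ℝ} {γ : Fin p → ℝ} {k : ℕ} {ε : ℝ}
  {a : Ω → Fin n → Fin n → ℝ} {ξ : Ω → Fin n → ℝ} {η : Ω → Fin p → ℝ}

lemma ae_mem_Icc (hM : IsNoisyNetwork P z β γ k ε a ξ η) (e : Pair n) : ∀ᵐ ω ∂P, a ω e.1.1 e.1.2 ∈ Set.Icc (0 : ℝ) 1 := by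
  have h := hM.edge_law _ _ e.2.ne
  rw [h.ae_iff (p := fun x : ℝ => x ∈ Set.Icc (0 : ℝ) 1) measurableSet_Icc.mem,
    bernoulliMeasure_def, ae_iff]
  simp

lemma integral_edge (hM : IsNoisyNetwork P z β γ k ε a ξ η) (e : Pair n) :
    ∫ ω, a ω e.1.1 e.1.2 ∂P = edgeProb z β γ e.1.1 e.1.2 := by
  rw [(hM.edge_law _ _ e.2.ne).integral_eq, integral_bernoulliMeasure]
  simp [edgeProb]
  rfl

lemma memLp_centred [IsProbabilityMeasure P]
    (hM : IsNoisyNetwork P z β γ k ε a ξ η) (e : Pair n) : MemLp (centred z β γ a e) 2 P := by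
  have h := hM.edge_law _ _ e.2.ne
  have h1 : MemLp (fun ω => a ω e.1.1 e.1.2) 2 P :=
    memLp_of_bounded (hM.ae_mem_Icc e) h.aemeasurable.aestronglyMeasurable 2
  exact h1.sub (memLp_const _)

lemma integral_centred [IsProbabilityMeasure P]
    (hM : IsNoisyNetwork P z β γ k ε a ξ η) (e : Pair n) : ∫ ω, centred z β γ a e ω ∂P = 0 := by
  have h1 : MemLp (fun ω => a ω e.1.1 e.1.2) 2 P :=
    memLp_of_bounded (hM.ae_mem_Icc e)
      (hM.edge_law _ _ e.2.ne).aemeasurable.aestronglyMeasurable 2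
  simp only [centred]
  rw [integral_sub (h1.integrable one_le_two) (integrable_const _), hM.integral_edge]
  simp

lemma integral_centred_sq (hM : IsNoisyNetwork P z β γ k ε a ξ η) (e : Pair n) :
    ∫ ω, centred z β γ a e ω ^ 2 ∂P = edgeVar z β γ e.1.1 e.1.2 := by
  have h := (hM.edge_law _ _ e.2.ne).integral_comp
    (f := fun x : ℝ => (x - edgeProb z β γ e.1.1 e.1.2) ^ 2) (by fun_prop)
  have h2 : ∫ ω, centred z β γ a e ω ^ 2 ∂P
      = P[(fun x : ℝ => (x - edgeProb z β γ e.1.1 e.1.2) ^ 2) ∘ fun ω => a ω e.1.1 e.1.2] := rfl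
  rw [h2, h, integral_bernoulliMeasure, edgeVar, sigmoidSlope, edgeProb]
  have h3 : ((unitInterval.sigmoid (linPred z β γ e.1.1 e.1.2) : unitInterval) : ℝ)
      = Real.sigmoid (linPred z β γ e.1.1 e.1.2) := rfl
  simp only [h3, smul_eq_mul]
  ring

lemma iIndepFun_centred (hM : IsNoisyNetwork P z β γ k ε a ξ η) : iIndepFun (centred z β γ a) P := by
  have h := hM.indep.precomp (g := (Sum.inl : Pair n → Pair n ⊕ Fin n ⊕ Fin p)) Sum.inl_injective
  exact h.comp (fun e x => x - edgeProb z β γ e.1.1 e.1.2) fun e => by fun_prop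

lemma hasSubgaussianMGF_centred [IsProbabilityMeasure P]
    (hM : IsNoisyNetwork P z β γ k ε a ξ η) (e : Pair n) :
    HasSubgaussianMGF (centred z β γ a e) (1 / 4) P := by
  have h := hasSubgaussianMGF_of_mem_Icc (hM.edge_law _ _ e.2.ne).aemeasurable (hM.ae_mem_Icc e)
  rw [hM.integral_edge e] at h
  convert! h using 1
  norm_num

lemma card_node_pairs (i : Fin n) :
    (Finset.univ.filter (fun e : Pair n => e.1.1 = i ∨ e.1.2 = i)).card = n - 1 := by
  have h := sum_mul_sum_erase (Pi.single i 1) (fun _ _ : Fin n => (1 : ℝ)) (fun _ _ => rfl)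
  simp only [Pi.single_apply, ite_mul, one_mul, zero_mul, Finset.sum_ite_eq', Finset.mem_univ,
    if_true, Finset.sum_const, nsmul_eq_mul, mul_one, Finset.card_erase_of_mem, Finset.card_univ,
    Fintype.card_fin] at h
  have h3 : ∑ e : Pair n, ((if e.1.1 = i then (1 : ℝ) else 0) + if e.1.2 = i then 1 else 0)
      = ((Finset.univ.filter (fun e : Pair n => e.1.1 = i ∨ e.1.2 = i)).card : ℝ) := by
    rw [Finset.card_filter, Nat.cast_sum]
    refine Finset.sum_congr rfl fun e _ => ?_
    have hne := e.2.ne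
    by_cases h1 : e.1.1 = i
    · have h2 : e.1.2 ≠ i := fun h2 => hne (h1.trans h2.symm)
      simp [h1, h2]
    · by_cases h2 : e.1.2 = i <;> simp [h1, h2]
  rw [h3] at h
  exact_mod_cast h.symm

/-- Hoeffding for `n - 1` edges with variance proxy `1 / 4`: each tail is at most `n⁻²`, which
leaves `2 / n` after a union over the nodes. -/
lemma measure_degree_le [IsProbabilityMeasure P]
    (hM : IsNoisyNetwork P z β γ k ε a ξ η) (hz : ∀ i j, z i j = z j i)
    (hn : 4 ≤ n) {T : ℝ} (hT : 1 ≤ T)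
    (i : Fin n) :
    P {ω | ¬ |∑ j ∈ Finset.univ.erase i, (a ω i j - edgeProb z β γ i j)|
      ≤ T * Real.sqrt (n * Real.log n)} ≤ ENNReal.ofReal (2 / n ^ 2) := by
  have hn4 : (4 : ℝ) ≤ n := by exact_mod_cast hn
  have hn0 : (0 : ℝ) < n := by linarith
  have hL : 0 ≤ Real.log n := Real.log_nonneg (by linarith)
  set s := Finset.univ.filter (fun e : Pair n => e.1.1 = i ∨ e.1.2 = i) with hs
  set τ := T * Real.sqrt (n * Real.log n) with hτ
  have hτ0 : 0 ≤ τ := by positivity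
  have hsub := HasSubgaussianMGF.sum_of_iIndepFun (s := s) hM.iIndepFun_centred
    fun e _ => hM.hasSubgaussianMGF_centred e
  have hexp : Real.exp (-τ ^ 2 / (2 * ((∑ _e ∈ s, (1 / 4) : NNReal) : ℝ))) ≤ 1 / n ^ 2 := by
    have h1 : ((∑ _e ∈ s, (1 / 4) : NNReal) : ℝ) = (n - 1) / 4 := by
      rw [NNReal.coe_sum, Finset.sum_const, hs, card_node_pairs, nsmul_eq_mul,
        Nat.cast_sub (show 1 ≤ n by omega)]
      push_cast
      ring
    rw [h1]
    have h2 : 1 / (n : ℝ) ^ 2 = Real.exp (-(2 * Real.log n)) := by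
      rw [Real.exp_neg, two_mul, Real.exp_add, Real.exp_log hn0, one_div, sq]
    rw [h2, Real.exp_le_exp, neg_div, neg_le_neg_iff, le_div_iff₀ (by linarith), hτ, mul_pow,
      Real.sq_sqrt (by positivity)]
    have h3 : 1 ≤ T ^ 2 := one_le_pow₀ hT
    have h4 : (n : ℝ) * Real.log n ≤ T ^ 2 * (n * Real.log n) :=
      le_mul_of_one_le_left (by positivity) h3
    nlinarith
  have hu := (hsub.measure_ge_le hτ0).trans hexp
  have hl := (hsub.neg.measure_ge_le hτ0).trans hexp
  have hset : {ω | ¬ |∑ j ∈ Finset.univ.erase i, (a ω i j - edgeProb z β γ i j)| ≤ τ}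
      ⊆ {ω | τ ≤ ∑ e ∈ s, centred z β γ a e ω}
        ∪ {ω | τ ≤ (-fun ω => ∑ e ∈ s, centred z β γ a e ω) ω} := by
    intro ω hω
    simp only [Set.mem_ofPred_eq, not_le, sum_centred_node hz hM.symm] at hω
    rcases lt_abs.1 hω with h | h
    · exact Or.inl h.le
    · exact Or.inr h.le
  refine (measure_mono hset).trans ((measure_union_le _ _).trans ?_)
  rw [← ofReal_measureReal (by finiteness), ← ofReal_measureReal (by finiteness),
    ← ENNReal.ofReal_add measureReal_nonneg measureReal_nonneg]
  refine ENNReal.ofReal_le_ofReal ?_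
  refine (add_le_add hu hl).trans_eq ?_
  ring

/-- The weighted predictors form the range of `φ`, of dimension at most `n + p ≤ (p + 1) n`, and
their squared norm is the information. The dimension, not the number of edges, sets the scale `√n`.
-/
lemma measure_score_le [IsProbabilityMeasure P]
    (hM : IsNoisyNetwork P z β γ k ε a ξ η) (hn : 4 ≤ n) {T : ℝ} (hT : 1 ≤ T) :
    P {ω | ¬ ∀ (c : Fin n → ℝ) (u : Fin p → ℝ),
      |∑ e : Pair n, (a ω e.1.1 e.1.2 - edgeProb z β γ e.1.1 e.1.2) * linPred z c u e.1.1 e.1.2|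
        ≤ T * Real.sqrt n * Real.sqrt (infoForm z β γ c u)}
      ≤ ENNReal.ofReal ((p + 1) / T ^ 2) := by
  have hn1 : (1 : ℝ) ≤ n := by exact_mod_cast (by omega : 1 ≤ n)
  have hn0 : (0 : ℝ) < n := by linarith
  have hv : ∀ e : Pair n, 0 < edgeVar z β γ e.1.1 e.1.2 := fun e => edgeVar_pos ..
  let φ : (Fin n → ℝ) × (Fin p → ℝ) →ₗ[ℝ] EuclideanSpace ℝ (Pair n) :=
    { toFun := fun x => WithLp.toLp 2 fun e =>
        Real.sqrt (edgeVar z β γ e.1.1 e.1.2) * linPred z x.1 x.2 e.1.1 e.1.2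
      map_add' := fun x y => by
        ext e
        simp [linPred_add, mul_add]
      map_smul' := fun r x => by
        ext e
        simp [linPred_smul, mul_left_comm] }
  obtain ⟨Z, hZ0, hZi, hZm, hZ⟩ := exists_uniform_bound hM.memLp_centred hM.iIndepFun_centred
    hM.integral_centred hM.integral_centred_sq hv (LinearMap.range φ)
  have hrank : (Module.finrank ℝ (LinearMap.range φ) : ℝ) ≤ (p + 1) * n := by
    have h1 : Module.finrank ℝ (LinearMap.range φ) ≤ n + p := by
      refine (LinearMap.finrank_range_le φ).trans_eq ?_
      simp
    have h2 : (Module.finrank ℝ (LinearMap.range φ) : ℝ) ≤ n + p := by exact_mod_cast h1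
    have : (p : ℝ) ≤ p * n := le_mul_of_one_le_right (Nat.cast_nonneg p) hn1
    linarith
  have hmk := measure_mul_lt_le (P := P) (Z := Z) (q := (p + 1) * n) (T := T ^ 2 / (p + 1))
    hZi.aemeasurable (by positivity) (by positivity) (by
      rw [← ofReal_integral_eq_lintegral_ofReal hZi (Eventually.of_forall hZ0), hZm]
      exact ENNReal.ofReal_le_ofReal hrank)
  rw [one_div_div] at hmk
  refine le_trans (measure_mono fun ω hω => ?_) hmk
  by_contra hle
  refine hω fun c u => ?_
  have hle' : Z ω ≤ T ^ 2 * n := by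
    have : ¬ T ^ 2 / (p + 1) * ((p + 1) * n) < Z ω := hle
    rw [not_lt] at this
    calc Z ω ≤ T ^ 2 / (p + 1) * ((p + 1) * n) := this
      _ = _ := by field_simp
  have h1 := hZ ω (φ (c, u)) ⟨_, rfl⟩
  have h2 : ∑ e, φ (c, u) e * (centred z β γ a e ω / Real.sqrt (edgeVar z β γ e.1.1 e.1.2))
      = ∑ e : Pair n, (a ω e.1.1 e.1.2 - edgeProb z β γ e.1.1 e.1.2)
        * linPred z c u e.1.1 e.1.2 := by
    refine Finset.sum_congr rfl fun e _ => ?_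
    have h3 := Real.sqrt_pos.2 (hv e)
    change Real.sqrt (edgeVar z β γ e.1.1 e.1.2) * linPred z c u e.1.1 e.1.2 * _ = _
    rw [centred]
    field_simp
  have h3 : ‖φ (c, u)‖ ^ 2 = infoForm z β γ c u := by
    rw [EuclideanSpace.norm_sq_eq, infoForm]
    refine Finset.sum_congr rfl fun e _ => ?_
    change ‖Real.sqrt (edgeVar z β γ e.1.1 e.1.2) * linPred z c u e.1.1 e.1.2‖ ^ 2 = _
    rw [Real.norm_eq_abs, sq_abs, mul_pow, Real.sq_sqrt (hv e).le]
  rw [h2, h3] at h1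
  have hS := infoForm_nonneg (z := z) (β := β) (γ := γ) c u
  refine abs_le_of_sq_le_sq ?_ (by positivity)
  rw [mul_pow, mul_pow, Real.sq_sqrt hn0.le, Real.sq_sqrt hS]
  exact h1.trans (mul_le_mul_of_nonneg_right hle' hS)

/-- Chebyshev for one deterministic direction, the variance being its information. There is no
dimension factor, so this gains `√n` over the uniform score bound. -/
lemma measure_representer_le [IsProbabilityMeasure P]
    (hM : IsNoisyNetwork P z β γ k ε a ξ η) {T q : ℝ} (hT : 1 ≤ T) (hq : 0 ≤ q) (c : Fin n → ℝ) (u : Fin p → ℝ)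
    (hS : infoForm z β γ c u ≤ q ^ 2) :
    P {ω | ¬ |∑ e : Pair n, (a ω e.1.1 e.1.2 - edgeProb z β γ e.1.1 e.1.2)
      * linPred z c u e.1.1 e.1.2| ≤ T * q} ≤ ENNReal.ofReal (1 / T ^ 2) := by
  have hint : MemLp (fun ω => ∑ e : Pair n, linPred z c u e.1.1 e.1.2 * centred z β γ a e ω) 2 P :=
    memLp_finsetSum _ fun e _ => (hM.memLp_centred e).const_mul _
  have hI := integral_sq_sum_mul hM.memLp_centred hM.iIndepFun_centred
    hM.integral_centred hM.integral_centred_sq (fun e : Pair n => linPred z c u e.1.1 e.1.2)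
  have hI' : ∫ ω, (∑ e : Pair n, linPred z c u e.1.1 e.1.2 * centred z β γ a e ω) ^ 2 ∂P
      ≤ q ^ 2 := by
    rw [hI]
    refine le_trans (le_of_eq ?_) hS
    exact Finset.sum_congr rfl fun e _ => mul_comm _ _
  have hmk := measure_mul_lt_le (P := P) (q := q ^ 2) (T := T ^ 2)
    hint.integrable_sq.aemeasurable (by positivity) (by positivity) (by
      rw [← ofReal_integral_eq_lintegral_ofReal hint.integrable_sq
        (Eventually.of_forall fun _ => sq_nonneg _)]
      exact ENNReal.ofReal_le_ofReal hI')
  refine le_trans (measure_mono fun ω hω => ?_) hmk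
  simp only [Set.mem_ofPred_eq, not_le] at hω ⊢
  have h2 : ∑ e : Pair n, linPred z c u e.1.1 e.1.2 * centred z β γ a e ω
      = ∑ e : Pair n, (a ω e.1.1 e.1.2 - edgeProb z β γ e.1.1 e.1.2)
        * linPred z c u e.1.1 e.1.2 := Finset.sum_congr rfl fun e _ => mul_comm _ _
  rw [h2, ← mul_pow, ← sq_abs (∑ e : Pair n, _)]
  exact pow_lt_pow_left₀ hω (by positivity) two_ne_zero

lemma measure_degree_noise_le (hM : IsNoisyNetwork P z β γ k ε a ξ η) {T C : ℝ} (hT : 1 ≤ T) (hC : 0 ≤ C)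
    (hξ : ∫⁻ x, ENNReal.ofReal (x ^ 2) ∂(discreteLaplace (Real.exp (-(ε / (4 * k)))))
      ≤ ENNReal.ofReal C) :
    P {ω | ¬ ∑ i, ξ ω i ^ 2 ≤ T ^ 2 * n} ≤ ENNReal.ofReal ((C + 1) / T ^ 2) := by
  have hmeas : ∀ i, AEMeasurable (fun ω => ξ ω i) P := fun i => (hM.degree_noise_law i).aemeasurable
  -- `C + 1` in place of `C` keeps the divisor positive.
  have hmk := measure_mul_lt_le (P := P) (q := (C + 1) * n) (T := T ^ 2 / (C + 1))
    (Z := fun ω => ∑ i, ξ ω i ^ 2)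
    (Finset.aemeasurable_fun_sum _ fun i _ => (hmeas i).pow_const 2)
    (by positivity) (by positivity) (by
      have h1 : ∀ i, ∫⁻ ω, ENNReal.ofReal (ξ ω i ^ 2) ∂P ≤ ENNReal.ofReal (C + 1) := by
        intro i
        have h := (hM.degree_noise_law i).lintegral_comp
          (f := fun x : ℝ => ENNReal.ofReal (x ^ 2)) (by fun_prop)
        rw [h]
        exact hξ.trans (ENNReal.ofReal_le_ofReal (by linarith))
      simp_rw [ENNReal.ofReal_sum_of_nonneg fun i (_ : i ∈ Finset.univ) => sq_nonneg _]
      rw [lintegral_finsetSum' _ fun i _ => ((hmeas i).pow_const 2).ennreal_ofReal]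
      refine (Finset.sum_le_sum fun i _ => h1 i).trans_eq ?_
      rw [Finset.sum_const, Finset.card_univ, Fintype.card_fin, nsmul_eq_mul, mul_comm (C + 1),
        ENNReal.ofReal_mul (Nat.cast_nonneg n), ENNReal.ofReal_natCast])
  rw [one_div_div] at hmk
  refine le_trans (measure_mono fun ω hω => ?_) hmk
  simp only [Set.mem_ofPred_eq, not_le] at hω ⊢
  calc T ^ 2 / (C + 1) * ((C + 1) * n) = T ^ 2 * n := by field_simp
    _ < _ := hω

lemma measure_cov_noise_le (hM : IsNoisyNetwork P z β γ k ε a ξ η) {T ζ : ℝ} (hT : 1 ≤ T) (hζ : 0 ≤ ζ) (hε : 0 < ε)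
    (hη : p * (2 * p * k * zStar z / ε) ≤ ζ) :
    P {ω | ¬ ∑ t, |η ω t| ≤ T * ζ} ≤ ENNReal.ofReal (1 / T) := by
  have hmeas : ∀ t, AEMeasurable (fun ω => |η ω t|) P := fun t =>
    (hM.cov_noise_law t).aemeasurable.abs
  have hs : 0 ≤ 2 * p * k * zStar z / ε := by
    have := zStar_nonneg (z := z)
    positivity
  have hmk := measure_mul_lt_le (P := P) (q := ζ) (T := T)
    (Z := fun ω => ∑ t, |η ω t|) (Finset.aemeasurable_fun_sum _ fun t _ => hmeas t)
    hζ (by positivity) (by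
      have h1 : ∀ t, ∫⁻ ω, ENNReal.ofReal |η ω t| ∂P
          = ENNReal.ofReal (2 * p * k * zStar z / ε) := by
        intro t
        have h := (hM.cov_noise_law t).lintegral_comp
          (f := fun x : ℝ => ENNReal.ofReal |x|) (by fun_prop)
        rw [h, lintegral_abs_laplace hs]
      simp_rw [ENNReal.ofReal_sum_of_nonneg fun i (_ : i ∈ Finset.univ) => abs_nonneg _]
      rw [lintegral_finsetSum' _ fun t _ => (hmeas t).ennreal_ofReal]
      simp_rw [h1]
      rw [Finset.sum_const, Finset.card_univ, Fintype.card_fin, nsmul_eq_mul,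
        ← ENNReal.ofReal_natCast, ← ENNReal.ofReal_mul (Nat.cast_nonneg p)]
      exact ENNReal.ofReal_le_ofReal hη)
  refine le_trans (measure_mono fun ω hω => ?_) hmk
  simpa only [Set.mem_ofPred_eq, not_le] using hω

/-- The noise of the network is small except on an event of small probability. -/
theorem measure_not_goodNoise_le [IsProbabilityMeasure P]
    (hM : IsNoisyNetwork P z β γ k ε a ξ η) (hz : ∀ i j, z i j = z j i)
    (hn : 4 ≤ n) {T C ζ ρ : ℝ}
    (hT : 1 ≤ T) (hC : 0 ≤ C) (hζ : zStar z ≤ ζ) (hζ0 : 0 ≤ ζ) (hρ : 0 ≤ ρ) (hε : 0 < ε)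
    (hξ : ∫⁻ x, ENNReal.ofReal (x ^ 2) ∂(discreteLaplace (Real.exp (-(ε / (4 * k)))))
      ≤ ENNReal.ofReal C)
    (hη : p * (2 * p * k * zStar z / ε) ≤ ζ)
    {α : Fin p → Fin n → ℝ} {h : Fin p → Fin p → ℝ}
    (hw : ∀ t, IsRepresenter z β γ (ρ / n ^ 2) t (α t) (h t)) :
    P {ω | ¬ GoodNoise z β γ ζ ρ T α h (fun i j => a ω i j - edgeProb z β γ i j) (ξ ω) (η ω)}
      ≤ ENNReal.ofReal ((2 * p + 3 + C) / T + 2 / n) := by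
  have hn1 : (1 : ℝ) ≤ n := by exact_mod_cast (by omega : 1 ≤ n)
  have hn0 : (0 : ℝ) < n := by linarith
  set q : ℝ := p * ζ * ρ / n with hq
  have hq0 : 0 ≤ q := by positivity
  have hS : ∀ t, infoForm z β γ (α t) (h t) ≤ q ^ 2 := by
    intro t
    have hK : ∀ i j, i ≠ j → |∑ s, z i j s * h t s| ≤ p * ζ * (ρ / n ^ 2) := by
      intro i j hij
      refine (abs_sum_mul_le hij _).trans ?_
      have := (hw t).norm_le
      gcongr
    refine ((hw t).infoForm_le hK).trans ?_
    have e : n * (p * ζ * (ρ / n ^ 2)) / 2 = q / 2 := by rw [hq]; field_simp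
    rw [e]
    nlinarith [sq_nonneg q]
  set E₁ := {ω | ¬ ∀ (c : Fin n → ℝ) (u : Fin p → ℝ),
    |∑ e : Pair n, (a ω e.1.1 e.1.2 - edgeProb z β γ e.1.1 e.1.2) * linPred z c u e.1.1 e.1.2|
      ≤ T * Real.sqrt n * Real.sqrt (infoForm z β γ c u)}
  set E₂ := {ω | ¬ ∑ i, ξ ω i ^ 2 ≤ T ^ 2 * n}
  set E₃ := {ω | ¬ ∑ t, |η ω t| ≤ T * ζ}
  set E₄ := ⋃ t, {ω | ¬ |∑ e : Pair n, (a ω e.1.1 e.1.2 - edgeProb z β γ e.1.1 e.1.2)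
      * linPred z (α t) (h t) e.1.1 e.1.2| ≤ T * q}
  set E₅ := ⋃ i, {ω | ¬ |∑ j ∈ Finset.univ.erase i, (a ω i j - edgeProb z β γ i j)|
      ≤ T * Real.sqrt (n * Real.log n)}
  have g1 : P E₁ ≤ _ := hM.measure_score_le hn hT
  have g2 : P E₂ ≤ _ := hM.measure_degree_noise_le hT hC hξ
  have g3 : P E₃ ≤ _ := hM.measure_cov_noise_le hT hζ0 hε hη
  have g4 : P E₄ ≤ ENNReal.ofReal (p * (1 / T ^ 2)) := by
    refine (measure_iUnion_fintype_le _ _).trans ?_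
    refine (Finset.sum_le_sum fun t _ => hM.measure_representer_le hT hq0 _ _ (hS t)).trans_eq ?_
    rw [Finset.sum_const, Finset.card_univ, Fintype.card_fin, nsmul_eq_mul,
      ENNReal.ofReal_mul (Nat.cast_nonneg p), ENNReal.ofReal_natCast]
  have g5 : P E₅ ≤ ENNReal.ofReal (n * (2 / n ^ 2)) := by
    refine (measure_iUnion_fintype_le _ _).trans ?_
    refine (Finset.sum_le_sum fun i _ => hM.measure_degree_le hz hn hT i).trans_eq ?_
    rw [Finset.sum_const, Finset.card_univ, Fintype.card_fin, nsmul_eq_mul,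
      ENNReal.ofReal_mul (Nat.cast_nonneg n), ENNReal.ofReal_natCast]
  have hsub : {ω | ¬ GoodNoise z β γ ζ ρ T α h (fun i j => a ω i j - edgeProb z β γ i j) (ξ ω)
      (η ω)} ⊆ E₁ ∪ (E₂ ∪ (E₃ ∪ (E₄ ∪ E₅))) := by
    intro ω hω
    by_contra hnot
    simp only [Set.mem_union, not_or] at hnot
    obtain ⟨h1, h2, h3, h4, h5⟩ := hnot
    refine hω ⟨fun i j => by rw [hM.symm, edgeProb_comm hz], not_not.1 h1, not_not.1 h2,
      not_not.1 h3, fun t => ?_, fun i => ?_⟩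
    · exact not_not.1 fun h' => h4 (Set.mem_iUnion.2 ⟨t, h'⟩)
    · exact not_not.1 fun h' => h5 (Set.mem_iUnion.2 ⟨i, h'⟩)
  refine (measure_mono hsub).trans ?_
  have hu := (measure_union_le (μ := P) E₁ (E₂ ∪ (E₃ ∪ (E₄ ∪ E₅)))).trans (add_le_add g1 ((measure_union_le _ _).trans
    (add_le_add g2 ((measure_union_le _ _).trans
      (add_le_add g3 ((measure_union_le _ _).trans (add_le_add g4 g5)))))))
  refine hu.trans ?_
  rw [← ENNReal.ofReal_add (by positivity) (by positivity),
    ← ENNReal.ofReal_add (by positivity) (by positivity),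
    ← ENNReal.ofReal_add (by positivity) (by positivity),
    ← ENNReal.ofReal_add (by positivity) (by positivity)]
  refine ENNReal.ofReal_le_ofReal ?_
  have hT2 : 1 / T ^ 2 ≤ 1 / T := by
    refine one_div_le_one_div_of_le (by positivity) ?_
    nlinarith
  have e5 : (n : ℝ) * (2 / n ^ 2) = 2 / n := by field_simp
  have hp : (0 : ℝ) ≤ p := Nat.cast_nonneg p
  have e6 : (2 * p + 3 + C) / T = (p + 1) * (1 / T) + ((C + 1) * (1 / T) + (1 / T + p * (1 / T))) := by
    ring
  have e7 : ((p : ℝ) + 1) / T ^ 2 = (p + 1) * (1 / T ^ 2) := by ring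
  have e8 : (C + 1) / T ^ 2 = (C + 1) * (1 / T ^ 2) := by ring
  rw [e5, e6, e7, e8]
  have := mul_le_mul_of_nonneg_left hT2 hp
  have := mul_le_mul_of_nonneg_left hT2 hC
  linarith

end IsNoisyNetwork

/-! ### From the rate conditions to the non-asymptotic regime. -/

section VarianceBound
variable {n p : ℕ} {z : Fin n → Fin n → Fin p → ℝ}

/-- Boundedness has to be checked, as `sSup` of an unbounded set is 0: the predictor is bounded on
the two balls. -/
lemma inv_edgeVar_le_bSup (βs : Fin n → ℝ) (γs : Fin p → ℝ) {r₁ r₂ : ℝ} (hr₁ : 0 ≤ r₁)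
    (hr₂ : 0 ≤ r₂) {i j : Fin n} (hij : i ≠ j) :
    (edgeVar z βs γs i j)⁻¹ ≤ bSup z βs γs r₁ r₂ := by
  refine le_csSup ⟨Real.exp (2 * (‖βs‖ + r₁) + p * zStar z * (‖γs‖ + r₂)) * 4, ?_⟩
    ⟨βs, Metric.mem_closedBall_self hr₁, γs, Metric.mem_closedBall_self hr₂, i, j, hij,
      sigmoidSlope_inv _⟩
  rintro _ ⟨β, hβ, γ, hγ, i, j, hij, rfl⟩
  rw [← sigmoidSlope_inv]
  refine (inv_sigmoidSlope_le 0 _).trans ?_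
  have h0 : (sigmoidSlope 0)⁻¹ = 4 := by
    rw [sigmoidSlope_inv]; norm_num
  rw [h0, sub_zero]
  refine mul_le_mul_of_nonneg_right (Real.exp_le_exp.2 ?_) (by norm_num)
  refine (abs_linPred_le hij β γ).trans ?_
  have hz0 := zStar_nonneg (z := z)
  have h1 : ‖β‖ ≤ ‖βs‖ + r₁ := norm_le_of_mem_closedBall hβ
  have h2 : ‖γ‖ ≤ ‖γs‖ + r₂ := norm_le_of_mem_closedBall hγ
  gcongr

lemma four_le_of_inv_edgeVar_le {β : Fin n → ℝ} {γ : Fin p → ℝ} {b : ℝ} (hn : 2 ≤ n)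
    (hb : ∀ i j, i ≠ j → (edgeVar z β γ i j)⁻¹ ≤ b) : 4 ≤ b := by
  have : Nontrivial (Fin n) := Fin.nontrivial_iff_two_le.2 hn
  obtain ⟨i, j, hij⟩ := exists_pair_ne (Fin n)
  refine le_trans ?_ (hb i j hij)
  rw [le_inv_comm₀ (by norm_num) (edgeVar_pos ..)]
  exact (sigmoidSlope_le _).trans_eq (by norm_num)

/-- Two small quantities give every condition of `Regime`. The 1000 in `κ` exceeds the constants 384
and 360 there, and surplus powers of `b ≥ 1` are discarded. -/
lemma regime_of_small {β : Fin n → ℝ} {γ : Fin p → ℝ} {b ζ ρ T κ : ℝ}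
    (hz : ∀ i j, z i j = z j i) (hn : 4 ≤ n) (hL : 1 ≤ Real.log n)
    (hb : ∀ i j, i ≠ j → (edgeVar z β γ i j)⁻¹ ≤ b) (hζ : zStar z ≤ ζ) (hζ1 : 1 ≤ ζ)
    (hρ : 0 ≤ ρ) (hT : 1 ≤ T) (hκ : κ = 1 / (1000 * (p + 1) * T))
    (hA : b ^ 4 * Real.log n ≤ κ ^ 2 * n) (hB : ζ ^ 2 * ρ * b ^ 3 ≤ κ ^ 2 * Real.sqrt n) :
    Regime z β γ b ζ ρ T := by
  have hb1 : 1 ≤ b := by linarith [four_le_of_inv_edgeVar_le (by omega) hb]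
  have hn1 : (1 : ℝ) ≤ n := by exact_mod_cast (by omega : 1 ≤ n)
  have hn0 : (0 : ℝ) < n := by linarith
  have hp : (0 : ℝ) ≤ p := Nat.cast_nonneg p
  have hκ0 : 0 < κ := by rw [hκ]; positivity
  have hκT : κ * (1000 * (p + 1) * T) = 1 := by rw [hκ]; field_simp
  have hpT : ((p : ℝ) + 1) ≤ (p + 1) * T := le_mul_of_one_le_right (by linarith) hT
  have hTp : T ≤ (p + 1) * T := le_mul_of_one_le_left (by linarith) (by linarith)
  have hκp : κ * (p + 1) ≤ 1 / 1000 := by nlinarith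
  have hκ2 : κ ^ 2 * (p + 1) ^ 2 ≤ 1 / 1000 := by
    rw [← mul_pow]
    have : 0 ≤ κ * (p + 1) := by positivity
    nlinarith
  have hκ1 : κ ^ 2 ≤ κ ^ 2 * (p + 1) ^ 2 :=
    le_mul_of_one_le_right (sq_nonneg _) (one_le_pow₀ (by linarith))
  have hsn : Real.sqrt n ≤ n := Real.sqrt_le_iff.2 ⟨hn0.le, by nlinarith⟩
  have hb3 : 1 ≤ b ^ 3 := one_le_pow₀ hb1
  have hbb3 : b ≤ b ^ 3 := le_self_pow₀ hb1 (by norm_num)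
  have hζρ : 0 ≤ ζ ^ 2 * ρ := by positivity
  have hZ : ζ ^ 2 * ρ ≤ κ ^ 2 * Real.sqrt n := (le_mul_of_one_le_right hζρ hb3).trans hB
  have hZb : ζ ^ 2 * ρ * b ≤ κ ^ 2 * Real.sqrt n :=
    (mul_le_mul_of_nonneg_left hbb3 hζρ).trans hB
  have hZn : ζ ^ 2 * ρ ≤ κ ^ 2 * n := hZ.trans (mul_le_mul_of_nonneg_left hsn (sq_nonneg _))
  have hbn : b ≤ κ ^ 2 * n := by
    refine le_trans ?_ hA
    calc b ≤ b ^ 4 := le_self_pow₀ hb1 (by norm_num)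
      _ ≤ b ^ 4 * Real.log n := le_mul_of_one_le_right (by positivity) hL
  have hκn : κ ^ 2 * n ≤ n := by
    have : κ ^ 2 ≤ 1 := by linarith
    exact mul_le_of_le_one_left hn0.le this
  refine ⟨hz, hn, hL, hb1, hb, hζ, hζ1, hρ, hT, ?_, hZn.trans hκn, ?_, ?_, ?_⟩
  · have h1 : 2 * (p : ℝ) ^ 2 * ζ ^ 2 * ρ ≤ 2 * (p + 1) ^ 2 * (κ ^ 2 * n) := by
      calc 2 * (p : ℝ) ^ 2 * ζ ^ 2 * ρ = 2 * p ^ 2 * (ζ ^ 2 * ρ) := by ring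
        _ ≤ 2 * (p + 1) ^ 2 * (κ ^ 2 * n) := by gcongr; linarith
    have h2 : κ ^ 2 * (p + 1) ^ 2 * n ≤ 1 / 1000 * n := mul_le_mul_of_nonneg_right hκ2 hn0.le
    have h3 : κ ^ 2 * n ≤ κ ^ 2 * (p + 1) ^ 2 * n := mul_le_mul_of_nonneg_right hκ1 hn0.le
    linarith
  · have h1 : b * Real.sqrt (Real.log n / n) ≤ κ := by
      refine abs_le_of_sq_le_sq' ?_ hκ0.le |>.2
      rw [mul_pow, Real.sq_sqrt (by positivity), ← mul_div_assoc, div_le_iff₀ hn0]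
      refine le_trans ?_ hA
      gcongr
      norm_num
    calc 384 * T * b * Real.sqrt (Real.log n / n)
        = 384 * T * (b * Real.sqrt (Real.log n / n)) := by ring
      _ ≤ 384 * T * κ := by gcongr
      _ < 1 := by nlinarith
  · have h1 : ζ * Real.sqrt b * Real.sqrt (ρ / n) ≤ κ := by
      refine abs_le_of_sq_le_sq' ?_ hκ0.le |>.2
      rw [mul_pow, mul_pow, Real.sq_sqrt (by positivity), Real.sq_sqrt (by positivity),
        ← mul_div_assoc, div_le_iff₀ hn0]
      calc ζ ^ 2 * b * ρ = ζ ^ 2 * ρ * b := by ring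
        _ ≤ κ ^ 2 * Real.sqrt n := hZb
        _ ≤ _ := mul_le_mul_of_nonneg_left hsn (sq_nonneg _)
    calc 360 * (p + 1) * T * ζ * Real.sqrt b * Real.sqrt (ρ / n)
        = 360 * (p + 1) * T * (ζ * Real.sqrt b * Real.sqrt (ρ / n)) := by ring
      _ ≤ 360 * (p + 1) * T * κ := by gcongr
      _ < 1 := by nlinarith
  · have hsb : Real.sqrt b ≤ b := Real.sqrt_le_iff.2 ⟨by linarith, by nlinarith⟩
    calc ζ ^ 2 * ρ * Real.sqrt b ≤ ζ ^ 2 * ρ * b := by gcongr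
      _ ≤ κ ^ 2 * Real.sqrt n := hZb
      _ ≤ 1 * Real.sqrt n := by gcongr; linarith
      _ = Real.sqrt n := one_mul _
      _ ≤ _ := Real.sqrt_le_sqrt (le_mul_of_one_le_right hn0.le hL)

end VarianceBound

/-! ### Asymptotics and the final theorem. -/

section Asymptotics

lemma eventually_le_log_natCast (A : ℝ) : ∀ᶠ n : ℕ in atTop, A ≤ Real.log n :=
  (Real.tendsto_log_atTop.comp tendsto_natCast_atTop_atTop).eventually_ge_atTop A

lemma eventually_pow_four_mul_log_le {b : ℕ → ℝ}
    (hb : b =o[atTop] fun n : ℕ => ((n : ℝ) / Real.log n) ^ ((1 : ℝ) / 4)) {c : ℝ} (hc : 0 < c) :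
    ∀ᶠ n in atTop, b n ^ 4 * Real.log n ≤ c ^ 4 * n := by
  filter_upwards [hb.bound hc, eventually_le_log_natCast 1] with n hn hL
  have hq : 0 ≤ (n : ℝ) / Real.log n := div_nonneg (Nat.cast_nonneg n) (by linarith)
  have h1 := pow_le_pow_left₀ (norm_nonneg _) hn 4
  rw [mul_pow, Real.norm_eq_abs, Real.norm_eq_abs, Even.pow_abs (by decide),
    Even.pow_abs (by decide), ← Real.rpow_natCast (_ ^ ((1 : ℝ) / 4)) 4, ← Real.rpow_mul hq] at h1
  norm_num at h1
  calc b n ^ 4 * Real.log n ≤ c ^ 4 * (n / Real.log n) * Real.log n :=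
        mul_le_mul_of_nonneg_right h1 (by linarith)
    _ = c ^ 4 * n := by field_simp

variable {p : ℕ} {Ω : ℕ → Type*} [∀ n, MeasurableSpace (Ω n)]
  {P : ∀ n, Measure (Ω n)} [∀ n, IsProbabilityMeasure (P n)]
  {z : ∀ n, Fin n → Fin n → Fin p → ℝ} {βs : ∀ n, Fin n → ℝ} {γs : ℕ → Fin p → ℝ}
  {k : ℕ → ℕ} {ε : ℕ → ℝ} {a : ∀ n, Ω n → Fin n → Fin n → ℝ} {ξ : ∀ n, Ω n → Fin n → ℝ}
  {η : ∀ n, Ω n → Fin p → ℝ} {r₁ r₂ b ρ : ℕ → ℝ}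

/-- With probability close to one, the estimator exists and all its versions satisfy the error
bounds. -/
theorem exists_bound_whp (hz : ∀ n i j, z n i j = z n j i)
    (hk : ∀ n, 0 < k n) (hε : ∀ n, 0 < ε n)
    (hmodel : ∀ n, IsNoisyNetwork (P n) (z n) (βs n) (γs n) (k n) (ε n) (a n) (ξ n) (η n))
    (hr₁ : ∀ n, 0 < r₁ n) (hr₂ : ∀ n, 0 < r₂ n)
    (hb : ∀ n, b n = bSup (z n) (βs n) (γs n) (r₁ n) (r₂ n))
    (hρ : ∀ᶠ n in atTop, ∀ β ∈ Metric.closedBall (βs n) (r₁ n),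
      IsUnit (H (z n) β (γs n)).det ∧ rowNorm (H (z n) β (γs n))⁻¹ ≤ ρ n / (n : ℝ) ^ 2)
    (hkε : Tendsto (fun n => (k n : ℝ) / ε n) atTop (𝓝 0))
    (hbo : b =o[atTop] fun n : ℕ => ((n : ℝ) / Real.log n) ^ ((1 : ℝ) / 4))
    (hρo : (fun n => ρ n * b n ^ 3) =o[atTop] fun n : ℕ => Real.sqrt n / Real.log n)
    (hzo : (fun n => zStar (z n)) =o[atTop] fun n : ℕ => Real.sqrt (Real.log n))
    {δ : ℝ} (hδ : 0 < δ) :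
    ∃ M : ℝ, 0 < M ∧ ∀ᶠ n in atTop, P n {ω | ¬ ((∃ (β : Fin n → ℝ) (γ : Fin p → ℝ),
        IsSolution (z n) (noisyDegree (a n ω) (ξ n ω)) (noisyCov (z n) (a n ω) (η n ω)) β γ) ∧
      ∀ (β : Fin n → ℝ) (γ : Fin p → ℝ),
        IsSolution (z n) (noisyDegree (a n ω) (ξ n ω)) (noisyCov (z n) (a n ω) (η n ω)) β γ →
        ‖γ - γs n‖ ≤ M * (ρ n * b n ^ 3 * Real.log n / n) ∧
        ‖β - βs n‖ ≤ M * (b n * Real.sqrt (Real.log n / n)))} ≤ ENNReal.ofReal δ := by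
  obtain ⟨C, hC, hlap⟩ := exists_discreteLaplace_sq_le
  have hp : (0 : ℝ) ≤ p := Nat.cast_nonneg p
  -- Chosen so that the part of the failure probability decaying in `T` takes `δ / 2`; the other
  -- half is for `2 / n`.
  set T : ℝ := 1 + 2 * (2 * p + 3 + C) / δ with hT
  have hT1 : 1 ≤ T := by
    have : 0 ≤ 2 * (2 * p + 3 + C) / δ := by positivity
    linarith
  have hTδ : (2 * p + 3 + C) / T ≤ δ / 2 := by
    rw [div_le_iff₀ (by linarith), hT]
    have : δ / 2 * (1 + 2 * (2 * p + 3 + C) / δ) = δ / 2 + (2 * p + 3 + C) := by field_simp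
    linarith
  set κ : ℝ := 1 / (1000 * (p + 1) * T) with hκ
  have hκ0 : 0 < κ := by positivity
  have hs : 0 < Real.sqrt κ := Real.sqrt_pos.2 hκ0
  have hs4 : Real.sqrt κ ^ 4 = κ ^ 2 := by
    rw [show 4 = 2 * 2 by norm_num, pow_mul, Real.sq_sqrt hκ0.le]
  refine ⟨12600 * (p + 1) ^ 2 * T ^ 2, by positivity, ?_⟩
  have ekε : ∀ᶠ n in atTop, (k n : ℝ) / ε n ≤ 1 / (100 * (p + 1) ^ 2) :=
    hkε.eventually_le_const (by positivity)
  have en : ∀ᶠ n : ℕ in atTop, 4 / δ ≤ (n : ℝ) :=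
    tendsto_natCast_atTop_atTop.eventually_ge_atTop (4 / δ)
  filter_upwards [hρ, ekε, en, eventually_ge_atTop 4, eventually_le_log_natCast 4,
    eventually_pow_four_mul_log_le hbo hs, hρo.bound (pow_pos hκ0 2), hzo.bound one_half_pos]
    with n hρn hkn hδn hn hL hbn hρbn hzn
  have hn1 : (1 : ℝ) ≤ n := by exact_mod_cast (by omega : 1 ≤ n)
  have hn0 : (0 : ℝ) < n := by linarith
  obtain ⟨hH, hHρ⟩ := hρn (βs n) (Metric.mem_closedBall_self (hr₁ n).le)
  have hρ0 : 0 ≤ ρ n := by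
    have h1 := (rowNorm_nonneg _).trans hHρ
    rw [le_div_iff₀ (by positivity), zero_mul] at h1
    exact h1
  have hinv : ∀ i j, i ≠ j → (edgeVar (z n) (βs n) (γs n) i j)⁻¹ ≤ b n := by
    intro i j hij
    rw [hb n]
    exact inv_edgeVar_le_bSup _ _ (hr₁ n).le (hr₂ n).le hij
  have hb1 : 1 ≤ b n := by linarith [four_le_of_inv_edgeVar_le (by omega) hinv]
  -- The added 1 keeps `ζ ≥ 1` when all covariates vanish. For `log n ≥ 4` both summands are at most
  -- `√(log n) / 2`, so `ζ² ≤ log n`, cancelling the logarithm in the condition on `ρ b³`.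
  set ζ : ℝ := zStar (z n) + 1 with hζ
  have hz0 := zStar_nonneg (z := z n)
  have hζ1 : 1 ≤ ζ := by linarith
  have hζL : ζ ^ 2 ≤ Real.log n := by
    rw [Real.norm_of_nonneg hz0, Real.norm_of_nonneg (Real.sqrt_nonneg _)] at hzn
    have h2 : 2 ≤ Real.sqrt (Real.log n) := Real.le_sqrt_of_sq_le (by linarith)
    have h3 : ζ ≤ Real.sqrt (Real.log n) := by linarith
    calc ζ ^ 2 ≤ Real.sqrt (Real.log n) ^ 2 := by gcongr
      _ = _ := Real.sq_sqrt (by linarith)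
  have hB : ζ ^ 2 * ρ n * b n ^ 3 ≤ κ ^ 2 * Real.sqrt n := by
    have h1 : ρ n * b n ^ 3 ≤ κ ^ 2 * (Real.sqrt n / Real.log n) := by
      refine (Real.le_norm_self _).trans (hρbn.trans_eq ?_)
      rw [Real.norm_of_nonneg (by positivity)]
    calc ζ ^ 2 * ρ n * b n ^ 3 = ζ ^ 2 * (ρ n * b n ^ 3) := by ring
      _ ≤ Real.log n * (κ ^ 2 * (Real.sqrt n / Real.log n)) := by gcongr
      _ = _ := by field_simp
  have hR : Regime (z n) (βs n) (γs n) (b n) ζ (ρ n) T :=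
    regime_of_small (hz n) hn (by linarith) hinv (by linarith) hζ1 hρ0 hT1 hκ (hs4 ▸ hbn) hB
  have hrep : ∀ t : Fin p, ∃ (α : Fin n → ℝ) (h : Fin p → ℝ),
      IsRepresenter (z n) (βs n) (γs n) (ρ n / n ^ 2) t α h := by
    intro t
    obtain ⟨α, h, h1, h2, h3⟩ := exists_representer (hz n) (by omega) (βs n) (γs n) hH t
    exact ⟨α, h, h1.trans hHρ, h2, h3⟩
  choose α h hw using hrep
  have hkpos : (0 : ℝ) < k n := by exact_mod_cast hk n
  have hkε1 : (k n : ℝ) * (100 * (p + 1) ^ 2) ≤ ε n := by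
    rw [div_le_div_iff₀ (hε n) (by positivity)] at hkn
    linarith
  have hp2 : 1 ≤ ((p : ℝ) + 1) ^ 2 := one_le_pow₀ (by linarith)
  have hl : Real.exp (-(ε n / (4 * k n))) ≤ 1 / 8 := by
    rw [Real.exp_neg, inv_eq_one_div]
    refine one_div_le_one_div_of_le (by norm_num) ?_
    have h1 : 25 ≤ ε n / (4 * k n) := by
      rw [le_div_iff₀ (by positivity)]
      nlinarith
    linarith [Real.add_one_le_exp (ε n / (4 * k n))]
  have hη : p * (2 * p * k n * zStar (z n) / ε n) ≤ ζ := by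
    have h1 : 2 * (p : ℝ) ^ 2 * k n ≤ ε n := by nlinarith
    calc p * (2 * p * k n * zStar (z n) / ε n)
        = 2 * (p : ℝ) ^ 2 * k n * zStar (z n) / ε n := by ring
      _ ≤ ε n * zStar (z n) / ε n := by
        have := hε n
        gcongr
      _ = zStar (z n) := mul_div_cancel_left₀ _ (hε n).ne'
      _ ≤ ζ := by linarith
  have hprob := (hmodel n).measure_not_goodNoise_le (hz n) hn hT1 hC
    (show zStar (z n) ≤ ζ by linarith) (by linarith) hρ0 (hε n)
    (hlap _ (Real.exp_pos _).le hl) hη hw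
  refine (measure_mono fun ω hω => ?_).trans (hprob.trans (ENNReal.ofReal_le_ofReal ?_))
  · refine fun hG => hω ?_
    have hd : ∀ i, noisyDegree (a n ω) (ξ n ω) i = meanDegree (z n) (βs n) (γs n) i
        + ∑ j ∈ Finset.univ.erase i, (a n ω i j - edgeProb (z n) (βs n) (γs n) i j)
        + ξ n ω i := by
      intro i
      rw [noisyDegree, degree, meanDegree, Finset.sum_sub_distrib]
      ring
    have hy : ∀ t, noisyCov (z n) (a n ω) (η n ω) t = meanCov (z n) (βs n) (γs n) t
        + ∑ e : Pair n, z n e.1.1 e.1.2 t *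
          (a n ω e.1.1 e.1.2 - edgeProb (z n) (βs n) (γs n) e.1.1 e.1.2) + η n ω t := by
      intro t
      simp only [noisyCov, covStat, meanCov, mul_sub, Finset.sum_sub_distrib]
      ring
    obtain ⟨hex, hbd⟩ := solution_bounds hR hw hG hd hy
    refine ⟨hex, fun β γ hsol => ?_⟩
    obtain ⟨h1, h2⟩ := hbd β γ hsol
    refine ⟨h1.trans ?_, h2⟩
    -- The bound obtained, `b ζ ρ / n`, is sharper than the stated rate; `ζ ≤ log n` and `b ≤ b³`
    -- weaken it.
    have h3 : ζ ≤ Real.log n := (le_self_pow₀ hζ1 two_ne_zero).trans hζL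
    have h4 : b n ≤ b n ^ 3 := le_self_pow₀ hb1 (by norm_num)
    calc 2500 * (p + 1) * T ^ 2 * (b n * ζ * ρ n / n)
        ≤ 12600 * (p + 1) ^ 2 * T ^ 2 * (b n ^ 3 * Real.log n * ρ n / n) := by
          have h5 : (p : ℝ) + 1 ≤ (p + 1) ^ 2 := le_self_pow₀ (by linarith) two_ne_zero
          gcongr
          norm_num
      _ = _ := by ring
  · have : 2 / (n : ℝ) ≤ δ / 2 := by
      rw [div_le_iff₀ hδ] at hδn
      rw [div_le_iff₀ hn0]
      linarith
    linarith

end Asymptotics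

end CovBeta

end

theorem corollary2 {p : ℕ} {Ω : ℕ → Type*} [∀ n, MeasurableSpace (Ω n)]
    (P : ∀ n, Measure (Ω n)) [∀ n, IsProbabilityMeasure (P n)]
    (z : ∀ n, Fin n → Fin n → Fin p → ℝ) (hz : ∀ n i j, z n i j = z n j i)
    (βs : ∀ n, Fin n → ℝ) (γs : ℕ → Fin p → ℝ)
    (k : ℕ → ℕ) (hk : ∀ n, 0 < k n) (ε : ℕ → ℝ) (hε : ∀ n, 0 < ε n)
    (a : ∀ n, Ω n → Fin n → Fin n → ℝ) (ξ : ∀ n, Ω n → Fin n → ℝ) (η : ∀ n, Ω n → Fin p → ℝ)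
    (hmodel : ∀ n, CovBeta.IsNoisyNetwork (P n) (z n) (βs n) (γs n) (k n) (ε n) (a n) (ξ n) (η n))
    -- the radii of the neighbourhoods of the true parameters, and the numbers `b_n`
    (r₁ r₂ : ℕ → ℝ) (hr₁ : ∀ n, 0 < r₁ n) (hr₂ : ∀ n, 0 < r₂ n)
    (b : ℕ → ℝ) (hb : ∀ n, b n = CovBeta.bSup (z n) (βs n) (γs n) (r₁ n) (r₂ n))
    -- the numbers `ρ_n`
    (ρ : ℕ → ℝ)
    (hρ : ∀ᶠ n in atTop, ∀ β ∈ Metric.closedBall (βs n) (r₁ n),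
      IsUnit (CovBeta.H (z n) β (γs n)).det ∧
        CovBeta.rowNorm (CovBeta.H (z n) β (γs n))⁻¹ ≤ ρ n / (n : ℝ) ^ 2)
    -- the rate conditions
    (hkε : Tendsto (fun n => (k n : ℝ) / ε n) atTop (𝓝 0))
    (hbo : b =o[atTop] fun n : ℕ => ((n : ℝ) / Real.log n) ^ ((1 : ℝ) / 4))
    (hρo : (fun n => ρ n * b n ^ 3) =o[atTop] fun n : ℕ => Real.sqrt n / Real.log n)
    (hzo : (fun n => CovBeta.zStar (z n)) =o[atTop] fun n : ℕ => Real.sqrt (Real.log n)) :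
    -- the estimator exists with probability tending to one
    Tendsto (fun n => P n {ω | ¬ ∃ (β : Fin n → ℝ) (γ : Fin p → ℝ),
        CovBeta.IsSolution (z n) (CovBeta.noisyDegree (a n ω) (ξ n ω))
          (CovBeta.noisyCov (z n) (a n ω) (η n ω)) β γ}) atTop (𝓝 0) ∧
    -- and every version of it satisfies the error bounds
    ∀ (βh : ∀ n, Ω n → Fin n → ℝ) (γh : ∀ n, Ω n → Fin p → ℝ),
      (∀ n ω, (∃ (β : Fin n → ℝ) (γ : Fin p → ℝ),
          CovBeta.IsSolution (z n) (CovBeta.noisyDegree (a n ω) (ξ n ω))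
            (CovBeta.noisyCov (z n) (a n ω) (η n ω)) β γ) →
        CovBeta.IsSolution (z n) (CovBeta.noisyDegree (a n ω) (ξ n ω))
          (CovBeta.noisyCov (z n) (a n ω) (η n ω)) (βh n ω) (γh n ω)) →
      CovBeta.IsBigOp P (fun n ω => ‖γh n ω - γs n‖)
          (fun n => ρ n * b n ^ 3 * Real.log n / n) ∧
        CovBeta.IsBigOp P (fun n ω => ‖βh n ω - βs n‖)
          (fun n => b n * Real.sqrt (Real.log n / n)) := by
  -- One event serves existence and both rates. Only monotonicity of the measure is used below, so
  -- the estimator need not be measurable.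
  have key := fun {δ : ℝ} (hδ : 0 < δ) => CovBeta.exists_bound_whp hz hk hε hmodel hr₁ hr₂ hb hρ
    hkε hbo hρo hzo hδ
  refine ⟨ENNReal.tendsto_nhds_zero.2 fun e he => ?_, fun βh γh hest => ⟨fun δ hδ => ?_,
    fun δ hδ => ?_⟩⟩
  · obtain ⟨δ, -, hδ, hδe⟩ := ENNReal.lt_iff_exists_real_btwn.1 he
    obtain ⟨M, -, hM⟩ := key (ENNReal.ofReal_pos.1 hδ)
    filter_upwards [hM] with n hn
    refine (measure_mono fun ω hω => ?_).trans (hn.trans hδe.le)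
    exact fun h => hω h.1
  · obtain ⟨M, hM0, hM⟩ := key hδ
    refine ⟨M, hM0, ?_⟩
    filter_upwards [hM] with n hn
    refine (measure_mono fun ω hω => ?_).trans hn
    simp only [Set.mem_ofPred_eq, abs_norm] at hω
    refine fun h => not_le.2 hω ?_
    exact (h.2 _ _ (hest n ω h.1)).1
  · obtain ⟨M, hM0, hM⟩ := key hδ
    refine ⟨M, hM0, ?_⟩
    filter_upwards [hM] with n hn
    refine (measure_mono fun ω hω => ?_).trans hn
    simp only [Set.mem_ofPred_eq, abs_norm] at hω
    refine fun h => not_le.2 hω ?_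
    exact (h.2 _ _ (hest n ω h.1)).2
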